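/- **The calculus $\lambda_{\mathrm{CL}}$.** Formulas are built from atoms $p_0,p_1,\dots$, $\top$ and $\bot$ by $\wedge$ and $\to$; $\neg A:=A\to\bot$. The atomic formulas are the $p_i$, $\top$ and $\bot$. A formula is *prime* if it is not a conjunction; every formula is a conjunction of prime formulas, its *prime factors*. $B$ is a *strong subformula* of $A$ if $B$ is a proper subformula of a prime proper subformula of $A$. Terms are typed (up to renaming of bound variables) by: $x^A:A$; $\mathsf{tt}:\top$; $\lambda x^A u:A\to B$ if $u:B$; $tu:B$ if $t:A\to B$, $u:A$; $\langle u,v\rangle:A\wedge B$ if $u:A$, $v:B$; $u\,\pi_0:A$ and $u\,\pi_1:B$ if $u:A\wedge B$; $\mathsf{efq}_P(u):P$ if $u:\bot$ and $P\ne\bot$ is atomic; $u\parallel v:A$ if $u:A$ and $v:A$; and (EM) $u\parallel_a v:B$ if $u:B$ and $v:B$, where the channel $a$ is bound in $u$ with type $\neg A$ and in $v$ with type $A$; $A$ is the *communication kind* of $a$. These rules are those of the natural deduction system $\mathbf{NJ}+(\mathrm{EM})$: $\mathbf{NJ}$ without disjunction, plus the contraction rule $\parallel$ and the rule (EM). A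 *simply typed $\lambda$-term* is a term without $\parallel$ and $\parallel_a$; a *simple parallel term* is $t_1\parallel\dots\parallel t_n$ with all $t_i$ simply typed; *parallel forms* are the terms obtained from simply typed $\lambda$-terms by $\parallel$ and $\parallel_a$. A context $\mathcal C[\,]$ is a term with exactly one hole. If $u\parallel_a v:T$ has the free variables $x_1^{A_1},\dots,x_n^{A_n}$, $a$ has kind $A$ and occurs in both $u$ and $v$, the *communication complexity* of $a$ is the maximum among $0$ and the numbers of symbols of the prime factors of $A$ that are neither proper subformulas of $T$ nor strong subformulas of any $A_i$. We call $a$ *active* in $u\parallel_a v$ if it occurs in both $u$ and $v$ and has communication complexity $>0$. The reduction $\mapsto$ contracts one redex anywhere in a term, by the following rules, where bound variables are renamed to avoid capture and $\xi$ is an argument term, a projection $\pi_i$ or $\mathsf{efq}_P$: * $(\lambda x^A u)t\mapsto u[t/x]$, $\ \langle u_0,u_1\rangle\pi_i\mapsto u_i$; * $w(u\parallel_a v)\mapsto wu\parallel_a wv$, $\ (u\parallel_a v)\xi\mapsto u\xi\parallel_a v\xi$, $\ \lambda x^A(u\parallel_a v)\mapsto\lambda x^A u\parallel_a\lambda x^A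 v$, $\ \langle u\parallel_a v,w\rangle\mapsto\langle u,w\rangle\parallel_a\langle v,w\rangle$, $\ \langle w,u\parallel_a v\rangle\mapsto\langle w,u\rangle\parallel_a\langle w,v\rangle$, and the same rules with $\parallel$ in place of $\parallel_a$; * if $b$ is active in the left-hand side: $(u\parallel_a v)\parallel_b w\mapsto(u\parallel_b w)\parallel_a(v\parallel_b w)$, $\ w\parallel_b(u\parallel_a v)\mapsto(w\parallel_b u)\parallel_a(w\parallel_b v)$, and the same rules with $\parallel$ in place of $\parallel_a$; * (basic cross) $\mathcal C[a\,u]\parallel_a\mathcal D\mapsto\mathcal D[u/a]$ if $a$ is active in the left-hand side, no free variable of $u$ is bound by $\mathcal C$, and $a$ does not occur in $u$; * $u\parallel_a v\mapsto u$ if $a$ does not occur in $u$, and $u\parallel_a v\mapsto v$ if $a$ does not occur in $v$; * (cross) $(\dots\parallel\mathcal C[a\,u]\parallel\dots)\parallel_a\mathcal D\mapsto(\mathcal C[b\,\langle y_1,\dots,y_k\rangle]\parallel_a\mathcal D)\parallel_b\mathcal D[u'/a]$ if $a$ is active in the left-hand side, $(\dots\parallel\mathcal C[a\,u]\parallel\dots)$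 is a normal simple parallel term having $\mathcal C[a\,u]$ as one of its simply typed components, the displayed occurrence of $a$ is the rightmost one in $\mathcal C[a\,u]$, $y_1^{B_1},\dots,y_k^{B_k}$ ($k\ge1$) are, without repetition, the free variables of $u$ that are bound by $\mathcal C$, $b$ is a fresh channel of kind $B_1\wedge\dots\wedge B_k$, and $u'$ is obtained from $u$ by replacing each $y_i$ by the $i$-th projection of $b$. A term is *normal* if no reduction step applies to it; $\mapsto^*$ is the reflexive and transitive closure of $\mapsto$. **Theorem (Normalization).** Let $t:A$ be a $\lambda_{\mathrm{CL}}$-term with free variables typed by $\Gamma$. Then $t\mapsto^* t'$ for some normal $t'$ which is in parallel form and has type $A$ in $\Gamma$. Consequently, every natural deduction proof of $A$ from $\Gamma$ in $\mathbf{NJ}+(\mathrm{EM})$ reduces in finitely many steps, through proofs of $A$ from $\Gamma$, to a normal proof of $A$ from $\Gamma$, where reduction and normality of proofs are those of the corresponding $\lambda_{\mathrm{CL}}$-terms. -/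

import Mathlib

namespace LambdaCL

/-! ### Formulas -/

/-- Propositional formulas; `top` is the empty conjunction. -/
inductive Formula : Type
  | atom (n : ℕ)
  | top
  | bot
  | and (A B : Formula)
  | imp (A B : Formula)

namespace Formula

/-- `¬ A` is shorthand for `A → ⊥`. -/
def neg (A : Formula) : Formula := imp A bot

/-- Atomic formulas. -/
def IsAtomic : Formula → Prop
  | atom _ => True
  | top => True
  | bot => True
  | and _ _ => False
  | imp _ _ => False

/-- Prime formulas: those that are not conjunctions. -/
def IsPrime (A : Formula) : Prop := ∀ B C : Formula, A ≠ and B C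

/-- The prime factors: the prime formulas of which the formula is a conjunction. -/
def primeFactors : Formula → List Formula
  | atom n => [atom n]
  | top => [top]
  | bot => [bot]
  | and A B => primeFactors A ++ primeFactors B
  | imp A B => [imp A B]

/-- The number of symbols. -/
def size : Formula → ℕ
  | atom _ => 1
  | top => 1
  | bot => 1
  | and A B => size A + size B + 1
  | imp A B => size A + size B + 1

/-- `Subformula B A`: the formula `B` is a subformula of `A`. -/
inductive Subformula : Formula → Formula → Prop
  | refl (A : Formula) : Subformula A A
  | and_left {B A₁ : Formula} (A₂ : Formula) : Subformula B A₁ → Subformula B (and A₁ A₂)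
  | and_right {B A₂ : Formula} (A₁ : Formula) : Subformula B A₂ → Subformula B (and A₁ A₂)
  | imp_left {B A₁ : Formula} (A₂ : Formula) : Subformula B A₁ → Subformula B (imp A₁ A₂)
  | imp_right {B A₂ : Formula} (A₁ : Formula) : Subformula B A₂ → Subformula B (imp A₁ A₂)

/-- `B` is a proper subformula of `A`. -/
def ProperSubformula (B A : Formula) : Prop := Subformula B A ∧ B ≠ A

/-- `B` is a strong subformula of `A`: a proper subformula of some prime proper subformula
of `A`. -/
def StrongSubformula (B A : Formula) : Prop :=
  ∃ C : Formula, IsPrime C ∧ ProperSubformula C A ∧ ProperSubformula B C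

/-- `A₁ ∧ (A₂ ∧ (⋯ ∧ Aₙ))`, which is `⊤` for `n = 0`. -/
def conj : List Formula → Formula
  | [] => top
  | [A] => A
  | A :: B :: l => and A (conj (B :: l))

end Formula

open Formula

/-! ### Terms

Terms are taken up to renaming of bound variables, by de Bruijn indices. In `lam A u` the
index `0` of `u` is the bound variable, of type `A`; in `em A u v` the index `0` of `u` is the
channel with type `¬ A` and the index `0` of `v` is the channel with type `A`. -/

/-- Raw terms: `em A u v` is `u ∥ₐ v` with `a` of kind `A`, and `par u v` is `u ∥ v`. -/
inductive Term : Type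
  | var (n : ℕ)
  | tt
  | lam (A : Formula) (u : Term)
  | app (u v : Term)
  | pair (u v : Term)
  | proj (i : Fin 2) (u : Term)
  | efq (P : Formula) (u : Term)
  | par (u v : Term)
  | em (A : Formula) (u v : Term)

/-- Extension of a renaming under one binder. -/
def liftRen (ρ : ℕ → ℕ) : ℕ → ℕ
  | 0 => 0
  | n + 1 => ρ n + 1

namespace Term

/-- Renaming of the free variables. -/
def rename : (ℕ → ℕ) → Term → Term
  | ρ, var n => var (ρ n)
  | _, tt => tt
  | ρ, lam A u => lam A (rename (liftRen ρ) u)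
  | ρ, app u v => app (rename ρ u) (rename ρ v)
  | ρ, pair u v => pair (rename ρ u) (rename ρ v)
  | ρ, proj i u => proj i (rename ρ u)
  | ρ, efq P u => efq P (rename ρ u)
  | ρ, par u v => par (rename ρ u) (rename ρ v)
  | ρ, em A u v => em A (rename (liftRen ρ) u) (rename (liftRen ρ) v)

/-- Extension of a substitution under one binder. -/
def liftSubst (σ : ℕ → Term) : ℕ → Term
  | 0 => var 0
  | n + 1 => rename Nat.succ (σ n)

/-- Simultaneous capture-avoiding substitution. -/
def subst : (ℕ → Term) → Term → Term
  | σ, var n => σ n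
  | _, tt => tt
  | σ, lam A u => lam A (subst (liftSubst σ) u)
  | σ, app u v => app (subst σ u) (subst σ v)
  | σ, pair u v => pair (subst σ u) (subst σ v)
  | σ, proj i u => proj i (subst σ u)
  | σ, efq P u => efq P (subst σ u)
  | σ, par u v => par (subst σ u) (subst σ v)
  | σ, em A u v => em A (subst (liftSubst σ) u) (subst (liftSubst σ) v)

/-- `u.inst t` is `u[t/x]`, where `x` is the variable `0` of `u`, which disappears. -/
def inst (u t : Term) : Term :=
  u.subst (fun n => match n with
    | 0 => t
    | m + 1 => var m)

/-- `u.Free n`: the variable `n` occurs free in `u`. -/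
def Free : Term → ℕ → Prop
  | var m, n => m = n
  | tt, _ => False
  | lam _ u, n => Free u (n + 1)
  | app u v, n => Free u n ∨ Free v n
  | pair u v, n => Free u n ∨ Free v n
  | proj _ u, n => Free u n
  | efq _ u, n => Free u n
  | par u v, n => Free u n ∨ Free v n
  | em _ u v, n => Free u (n + 1) ∨ Free v (n + 1)

/-- Simply typed `λ`-terms: no parallel operator occurs. -/
def IsSimple : Term → Prop
  | var _ => True
  | tt => True
  | lam _ u => IsSimple u
  | app u v => IsSimple u ∧ IsSimple v
  | pair u v => IsSimple u ∧ IsSimple v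
  | proj _ u => IsSimple u
  | efq _ u => IsSimple u
  | par _ _ => False
  | em _ _ _ => False

/-- The list of terms `t₁, …, tₙ` when the term is written as `t₁ ∥ ⋯ ∥ tₙ`, with `n` as large
as possible. -/
def components : Term → List Term
  | par u v => components u ++ components v
  | var n => [var n]
  | tt => [tt]
  | lam A u => [lam A u]
  | app u v => [app u v]
  | pair u v => [pair u v]
  | proj i u => [proj i u]
  | efq P u => [efq P u]
  | em A u v => [em A u v]

/-- Simple parallel terms `t₁ ∥ ⋯ ∥ tₙ` with every `tᵢ` a simply typed `λ`-term. -/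
def IsSimpleParallel (t : Term) : Prop := ∀ s ∈ t.components, s.IsSimple

/-- `⟨t₁, ⟨t₂, ⋯ tₙ⟩⟩`, which is `tt` for `n = 0`. -/
def tuple : List Term → Term
  | [] => tt
  | [t] => t
  | t :: s :: l => pair t (tuple (s :: l))

/-- For `v` of type `A₁ ∧ (A₂ ∧ (⋯ ∧ Aₙ))`, the list of its `n` projections, of types
`A₁, …, Aₙ`. -/
def projections : ℕ → Term → List Term
  | 0, _ => []
  | 1, v => [v]
  | n + 2, v => proj 0 v :: projections (n + 1) (proj 1 v)

/-- Parallel forms. -/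
inductive ParallelForm : Term → Prop
  | simple {t : Term} : t.IsSimple → ParallelForm t
  | em (A : Formula) {u v : Term} : ParallelForm u → ParallelForm v → ParallelForm (em A u v)
  | par {u v : Term} : ParallelForm u → ParallelForm v → ParallelForm (par u v)

end Term

open Term

/-! ### Typing and natural deduction -/

/-- `HasType Γ t A` is `Γ ⊢ t : A`: the term `t` has type `A` when its free variable `n` has the
type `Γ[n]`. -/
inductive HasType : List Formula → Term → Formula → Prop
  | var {Γ : List Formula} {n : ℕ} {A : Formula} : Γ[n]? = some A → HasType Γ (var n) A
  | tt {Γ : List Formula} : HasType Γ tt top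
  | lam {Γ : List Formula} {A B : Formula} {u : Term} :
      HasType (A :: Γ) u B → HasType Γ (lam A u) (imp A B)
  | app {Γ : List Formula} {A B : Formula} {t u : Term} :
      HasType Γ t (imp A B) → HasType Γ u A → HasType Γ (app t u) B
  | pair {Γ : List Formula} {A B : Formula} {u v : Term} :
      HasType Γ u A → HasType Γ v B → HasType Γ (pair u v) (and A B)
  | proj_zero {Γ : List Formula} {A B : Formula} {u : Term} :
      HasType Γ u (and A B) → HasType Γ (proj 0 u) A
  | proj_one {Γ : List Formula} {A B : Formula} {u : Term} :
      HasType Γ u (and A B) → HasType Γ (proj 1 u) B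
  | efq {Γ : List Formula} {P : Formula} {u : Term} :
      P.IsAtomic → P ≠ bot → HasType Γ u bot → HasType Γ (efq P u) P
  | par {Γ : List Formula} {A : Formula} {u v : Term} :
      HasType Γ u A → HasType Γ v A → HasType Γ (par u v) A
  | em {Γ : List Formula} {A B : Formula} {u v : Term} :
      HasType (neg A :: Γ) u B → HasType (A :: Γ) v B → HasType Γ (em A u v) B

/-- Natural deduction proofs of `A` from the list of hypotheses `Γ` in the calculus `NJ + (EM)`. -/
inductive Deriv : List Formula → Formula → Type
  | hyp {Γ : List Formula} {A : Formula} (n : ℕ) : Γ[n]? = some A → Deriv Γ A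
  | topI {Γ : List Formula} : Deriv Γ top
  | impI {Γ : List Formula} {A B : Formula} : Deriv (A :: Γ) B → Deriv Γ (imp A B)
  | impE {Γ : List Formula} {A B : Formula} : Deriv Γ (imp A B) → Deriv Γ A → Deriv Γ B
  | andI {Γ : List Formula} {A B : Formula} : Deriv Γ A → Deriv Γ B → Deriv Γ (and A B)
  | andE₀ {Γ : List Formula} {A B : Formula} : Deriv Γ (and A B) → Deriv Γ A
  | andE₁ {Γ : List Formula} {A B : Formula} : Deriv Γ (and A B) → Deriv Γ B
  | efq {Γ : List Formula} (P : Formula) :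
      P.IsAtomic → P ≠ bot → Deriv Γ bot → Deriv Γ P
  | contr {Γ : List Formula} {A : Formula} : Deriv Γ A → Deriv Γ A → Deriv Γ A
  | em {Γ : List Formula} (A : Formula) {B : Formula} :
      Deriv (neg A :: Γ) B → Deriv (A :: Γ) B → Deriv Γ B

/-- The term that decorates a natural deduction proof. -/
def Deriv.toTerm : {Γ : List Formula} → {A : Formula} → Deriv Γ A → Term
  | _, _, .hyp n _ => .var n
  | _, _, .topI => .tt
  | _, _, .impI (A := A) d => .lam A d.toTerm
  | _, _, .impE d e => .app d.toTerm e.toTerm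
  | _, _, .andI d e => .pair d.toTerm e.toTerm
  | _, _, .andE₀ d => .proj 0 d.toTerm
  | _, _, .andE₁ d => .proj 1 d.toTerm
  | _, _, .efq P _ _ d => .efq P d.toTerm
  | _, _, .contr d e => .par d.toTerm e.toTerm
  | _, _, .em A d e => .em A d.toTerm e.toTerm

/-! ### Contexts with one hole -/

/-- Terms with a hole that occurs exactly once. -/
inductive Cxt : Type
  | hole
  | lam (A : Formula) (C : Cxt)
  | appL (C : Cxt) (t : Term)
  | appR (t : Term) (C : Cxt)
  | pairL (C : Cxt) (t : Term)
  | pairR (t : Term) (C : Cxt)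
  | proj (i : Fin 2) (C : Cxt)
  | efq (P : Formula) (C : Cxt)
  | parL (C : Cxt) (t : Term)
  | parR (t : Term) (C : Cxt)
  | emL (A : Formula) (C : Cxt) (t : Term)
  | emR (A : Formula) (t : Term) (C : Cxt)

namespace Cxt

/-- Replacement of the hole by a term, without renaming bound variables: the variables `n` with
`n < C.depth` of the term are captured, and its variable `n + C.depth` becomes the free variable
`n` of the result. -/
def fill : Cxt → Term → Term
  | hole, s => s
  | lam A C, s => .lam A (fill C s)
  | appL C t, s => .app (fill C s) t
  | appR t C, s => .app t (fill C s)
  | pairL C t, s => .pair (fill C s) t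
  | pairR t C, s => .pair t (fill C s)
  | proj i C, s => .proj i (fill C s)
  | efq P C, s => .efq P (fill C s)
  | parL C t, s => .par (fill C s) t
  | parR t C, s => .par t (fill C s)
  | emL A C t, s => .em A (fill C s) t
  | emR A t C, s => .em A t (fill C s)

/-- The types of the variables that are bound at the hole, the innermost first. -/
def binders : Cxt → List Formula
  | hole => []
  | lam A C => binders C ++ [A]
  | appL C _ => binders C
  | appR _ C => binders C
  | pairL C _ => binders C
  | pairR _ C => binders C
  | proj _ C => binders C
  | efq _ C => binders C
  | parL C _ => binders C
  | parR _ C => binders C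
  | emL A C _ => binders C ++ [neg A]
  | emR A _ C => binders C ++ [A]

/-- The number of binders above the hole. -/
def depth (C : Cxt) : ℕ := C.binders.length

/-- Renaming of the free variables of a context. -/
def rename : (ℕ → ℕ) → Cxt → Cxt
  | _, hole => hole
  | ρ, lam A C => lam A (rename (liftRen ρ) C)
  | ρ, appL C t => appL (rename ρ C) (t.rename ρ)
  | ρ, appR t C => appR (t.rename ρ) (rename ρ C)
  | ρ, pairL C t => pairL (rename ρ C) (t.rename ρ)
  | ρ, pairR t C => pairR (t.rename ρ) (rename ρ C)
  | ρ, proj i C => proj i (rename ρ C)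
  | ρ, efq P C => efq P (rename ρ C)
  | ρ, parL C t => parL (rename ρ C) (t.rename ρ)
  | ρ, parR t C => parR (t.rename ρ) (rename ρ C)
  | ρ, emL A C t => emL A (rename (liftRen ρ) C) (t.rename (liftRen ρ))
  | ρ, emR A t C => emR A (t.rename (liftRen ρ)) (rename (liftRen ρ) C)

/-- `C.FreeRight n`: the variable `n` occurs free in `C` somewhere to the right of the hole. -/
def FreeRight : Cxt → ℕ → Prop
  | hole, _ => False
  | lam _ C, n => FreeRight C (n + 1)
  | appL C t, n => FreeRight C n ∨ t.Free n
  | appR _ C, n => FreeRight C n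
  | pairL C t, n => FreeRight C n ∨ t.Free n
  | pairR _ C, n => FreeRight C n
  | proj _ C, n => FreeRight C n
  | efq _ C, n => FreeRight C n
  | parL C t, n => FreeRight C n ∨ t.Free n
  | parR _ C, n => FreeRight C n
  | emL _ C t, n => FreeRight C (n + 1) ∨ t.Free (n + 1)
  | emR _ _ C, n => FreeRight C (n + 1)

end Cxt

/-- Stacks of length one: a term, a projection, or `efq_P`. -/
inductive Elim : Type
  | arg (t : Term)
  | proj (i : Fin 2)
  | efq (P : Formula)

/-- The term `t ξ`. -/
def Elim.plug : Elim → Term → Term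
  | arg s, t => .app t s
  | proj i, t => .proj i t
  | efq P, t => .efq P t

/-- Weakening of a one-element stack by one fresh variable, which becomes the variable `0`. -/
def Elim.weaken : Elim → Elim
  | arg s => arg (s.rename Nat.succ)
  | proj i => proj i
  | efq P => efq P

/-! ### Communication complexity -/

/-- The communication complexity of the channel of `em A u v`, a term of type `T` with free
variables typed by `Γ`: the maximum among `0` and the numbers of symbols of the prime factors of
`A` that are neither proper subformulas of `T` nor strong subformulas of the type of any variable
that occurs free in `em A u v`. -/
noncomputable def commComplexity (Γ : List Formula) (T A : Formula) (u v : Term) : ℕ :=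
  sSup {k : ℕ | ∃ P ∈ A.primeFactors, ¬ ProperSubformula P T ∧
    (∀ (n : ℕ) (C : Formula), (Term.em A u v).Free n → Γ[n]? = some C → ¬ StrongSubformula P C) ∧
    k = P.size}

/-- The channel of `em A u v` occurs in both `u` and `v`, so that it has a communication
complexity, and this complexity is greater than `0`. (If it fails to occur in `u` or in `v`, then
`em A u v` is a redex anyway, by one of the rules that erase the operator.) -/
def Active (Γ : List Formula) (A : Formula) (u v : Term) : Prop :=
  u.Free 0 ∧ v.Free 0 ∧
    ∃ T : Formula, HasType Γ (Term.em A u v) T ∧ 0 < commComplexity Γ T A u v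

/-! ### Reductions -/

/-- The intuitionistic redexes and their contracta. -/
inductive IntRedex : Term → Term → Prop
  | beta (A : Formula) (u t : Term) : IntRedex (app (lam A u) t) (u.inst t)
  | proj_zero (u v : Term) : IntRedex (proj 0 (pair u v)) u
  | proj_one (u v : Term) : IntRedex (proj 1 (pair u v)) v

/-- Normality with respect to the intuitionistic reductions; for a simple parallel term this is
normality, see `normal_iff_intNormal`. -/
def IntNormal (t : Term) : Prop :=
  ∀ (C : Cxt) (s s' : Term), t = C.fill s → ¬ IntRedex s s'

/-- Exchange of the two innermost variables. -/
def swapRen : ℕ → ℕ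
  | 0 => 1
  | 1 => 0
  | n + 2 => n + 2

/-- Insertion of a fresh variable at position `1`, keeping the variable `0`. -/
def insertRen : ℕ → ℕ := liftRen Nat.succ

/-- The substitution that turns the message `u` of a cross reduction into `u^{b/y}`. The message
lives below `d` binders, which are below the channel `a`: its variables `n < d` are bound by the
context, `d` is the channel `a` (which does not occur), and `n > d` is the variable `n - d - 1` of
the whole term. In the result `b` is the variable `0`, the variables in the list `ys` are replaced
by the projections of `b`, and the variables of the whole term are shifted by one. -/
def messageSubst (d : ℕ) (ys : List ℕ) (n : ℕ) : Term :=
  if n < d then (projections ys.length (var 0)).getD (ys.idxOf n) tt else var (n - d)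

/-- `D[t/a]` where `a` is the variable `0` of `D` and where a fresh variable, which may occur in `t`,
becomes the variable `0` of the result. -/
def receive (t D : Term) : Term :=
  D.subst (fun n => match n with
    | 0 => t
    | m + 1 => var (m + 1))

/-- The redexes of all reduction rules and their contracta, for terms with free variables typed
by `Γ`. -/
inductive Redex (Γ : List Formula) : Term → Term → Prop
  -- intuitionistic reductions
  | int {t t' : Term} : IntRedex t t' → Redex Γ t t'
  -- permutations
  | app_em (A : Formula) (w u v : Term) :
      Redex Γ (app w (em A u v))
        (em A (app (w.rename Nat.succ) u) (app (w.rename Nat.succ) v))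
  | em_elim (A : Formula) (u v : Term) (ξ : Elim) :
      Redex Γ (ξ.plug (em A u v)) (em A (ξ.weaken.plug u) (ξ.weaken.plug v))
  | app_par (w u v : Term) : Redex Γ (app w (par u v)) (par (app w u) (app w v))
  | par_elim (u v : Term) (ξ : Elim) : Redex Γ (ξ.plug (par u v)) (par (ξ.plug u) (ξ.plug v))
  | lam_em (A B : Formula) (u v : Term) :
      Redex Γ (lam A (em B u v)) (em B (lam A (u.rename swapRen)) (lam A (v.rename swapRen)))
  | pair_em_left (A : Formula) (u v w : Term) :
      Redex Γ (pair (em A u v) w)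
        (em A (pair u (w.rename Nat.succ)) (pair v (w.rename Nat.succ)))
  | pair_em_right (A : Formula) (u v w : Term) :
      Redex Γ (pair w (em A u v))
        (em A (pair (w.rename Nat.succ) u) (pair (w.rename Nat.succ) v))
  | lam_par (A : Formula) (u v : Term) : Redex Γ (lam A (par u v)) (par (lam A u) (lam A v))
  | pair_par_left (u v w : Term) : Redex Γ (pair (par u v) w) (par (pair u w) (pair v w))
  | pair_par_right (u v w : Term) : Redex Γ (pair w (par u v)) (par (pair w u) (pair w v))
  | em_em_left (A B : Formula) (u v w : Term) : Active Γ B (em A u v) w →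
      Redex Γ (em B (em A u v) w)
        (em A (em B (u.rename swapRen) (w.rename insertRen))
          (em B (v.rename swapRen) (w.rename insertRen)))
  | em_em_right (A B : Formula) (u v w : Term) : Active Γ B w (em A u v) →
      Redex Γ (em B w (em A u v))
        (em A (em B (w.rename insertRen) (u.rename swapRen))
          (em B (w.rename insertRen) (v.rename swapRen)))
  | em_par_left (B : Formula) (u v w : Term) : Active Γ B (par u v) w →
      Redex Γ (em B (par u v) w) (par (em B u w) (em B v w))
  | em_par_right (B : Formula) (u v w : Term) : Active Γ B w (par u v) →
      Redex Γ (em B w (par u v)) (par (em B w u) (em B w v))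
  -- basic cross reduction `𝒞[a u] ∥ₐ 𝒟 ↦ 𝒟[u/a]`: the message below the binders of `𝒞` and `a`
  -- is the weakening of a term `u` over the variables of the whole term, i.e. it contains neither
  -- `a` nor a variable bound by `𝒞`
  | basic_cross (A : Formula) (C : Cxt) (u D : Term) :
      Active Γ A (C.fill (app (var C.depth) (u.rename (fun n => n + (C.depth + 1))))) D →
      Redex Γ (em A (C.fill (app (var C.depth) (u.rename (fun n => n + (C.depth + 1))))) D)
        (D.inst u)
  -- `u ∥ₐ v ↦ u` if `a` does not occur in `u`, and `u ∥ₐ v ↦ v` if `a` does not occur in `v`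
  | erase_right (A : Formula) (u v : Term) : Redex Γ (em A (u.rename Nat.succ) v) u
  | erase_left (A : Formula) (u v : Term) : Redex Γ (em A u (v.rename Nat.succ)) v
  -- cross reduction
  -- `(⋯ ∥ 𝒞[a u] ∥ ⋯) ∥ₐ 𝒟 ↦ (𝒞[b ⟨y⟩] ∥ₐ 𝒟) ∥_b 𝒟[u^{b/y}/a]`
  | cross (A : Formula) (L : Term) (C : Cxt) (u D : Term) (ys : List ℕ) :
      L.IsSimpleParallel → IntNormal L →
      C.fill (app (var C.depth) u) ∈ L.components →
      -- the displayed occurrence of `a` is the rightmost one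
      ¬ u.Free C.depth → ¬ C.FreeRight 0 →
      -- `ys` enumerates the free variables of `u` bound by the context
      ys ≠ [] → ys.Nodup → (∀ n : ℕ, n ∈ ys ↔ u.Free n ∧ n < C.depth) →
      Active Γ A L D →
      Redex Γ (em A L D)
        (em (conj (ys.map (fun n => C.binders.getD n top)))
          (em A
            ((C.rename insertRen).fill (app (var (C.depth + 1)) (tuple (ys.map var))))
            (D.rename insertRen))
          (receive (u.subst (messageSubst C.depth ys)) D))

/-- One reduction step `t ↦ t'` for terms with free variables typed by `Γ`: the contraction of one
redex occurring anywhere in the term. -/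
def Step (Γ : List Formula) (t t' : Term) : Prop :=
  ∃ (C : Cxt) (s s' : Term), t = C.fill s ∧ t' = C.fill s' ∧ Redex (C.binders ++ Γ) s s'

/-- The reflexive and transitive closure `t ↦* t'`: reduction in finitely many steps. -/
def Reduces (Γ : List Formula) : Term → Term → Prop := Relation.ReflTransGen (Step Γ)

/-- Normal forms: no reduction step is possible. -/
def Normal (Γ : List Formula) (t : Term) : Prop := ¬ ∃ t' : Term, Step Γ t t'

/-- One reduction step between natural deduction proofs of the same formula from the same
hypotheses. -/
def Deriv.Step {Γ : List Formula} {A : Formula} (d d' : Deriv Γ A) : Prop :=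
  LambdaCL.Step Γ d.toTerm d'.toTerm

/-- Normal natural deduction proofs. -/
def Deriv.Normal {Γ : List Formula} {A : Formula} (d : Deriv Γ A) : Prop :=
  LambdaCL.Normal Γ d.toTerm

/-! ### Normality of simple parallel terms -/

theorem isSimple_of_fill (C : Cxt) (s : Term) (h : (C.fill s).IsSimple) : s.IsSimple := by
  induction C <;> simp_all [Cxt.fill, IsSimple]

theorem IsSimple.isSimpleParallel {t : Term} (h : t.IsSimple) : t.IsSimpleParallel := by
  cases t <;> simp_all [IsSimpleParallel, components, IsSimple]

theorem isSimpleParallel_of_fill (C : Cxt) (s : Term) (h : (C.fill s).IsSimpleParallel) :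
    s.IsSimpleParallel := by
  induction C with
  | hole => exact h
  | parL C t ih =>
    exact ih fun r hr => h r (by simp [Cxt.fill, components, hr])
  | parR t C ih =>
    exact ih fun r hr => h r (by simp [Cxt.fill, components, hr])
  | _ =>
    refine IsSimple.isSimpleParallel ?_
    simp only [IsSimpleParallel, Cxt.fill, components, List.mem_singleton, forall_eq,
      IsSimple] at h <;>
    first
      | exact isSimple_of_fill _ _ h
      | exact isSimple_of_fill _ _ h.1
      | exact isSimple_of_fill _ _ h.2

/-- A simple parallel term is normal if and only if no intuitionistic reduction applies to it. -/
theorem normal_iff_intNormal (Γ : List Formula) {t : Term} (ht : t.IsSimpleParallel) :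
    Normal Γ t ↔ IntNormal t := by
  constructor
  · rintro h C s s' rfl hs
    exact h ⟨_, C, s, s', rfl, rfl, .int hs⟩
  · rintro h ⟨t', C, s, s', rfl, rfl, hs⟩
    have hp := isSimpleParallel_of_fill C s ht
    cases hs with
    | int hs => exact h C s s' rfl hs
    | em_elim A u v ξ =>
      cases ξ <;> simp [IsSimpleParallel, components, Elim.plug, IsSimple] at hp
    | par_elim u v ξ =>
      cases ξ <;> simp [IsSimpleParallel, components, Elim.plug, IsSimple] at hp
    | _ => simp [IsSimpleParallel, components, IsSimple] at hp

end LambdaCL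

/-!
Reduction is confined to a strategy. Permutations bring any term into parallel form
(`exists_parallelForm`), and simply typed terms have normal forms (`exists_isNf_of_isSimple`, by
reducibility candidates). What remains is to organize the cross reductions.

Fix a set `S` of formulas that is closed under proper subformulas, contains the proper subformulas
of the type `T`, and contains the strong subformulas of the types of all free variables. A channel
whose kind `A` has a prime factor outside `S` is active wherever it occurs on both sides
(`active_of_not_factorsIn`). In a simply typed normal term its rightmost occurrence is applied to
a message `u`, and the types of the variables of `u` that are bound above it have all their prime
factors in `S` (`exists_message`, a form of the subformula property). Hence a cross reduction is
possible, it removes one occurrence of the channel from the sender, and the channel that it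
creates is harmless relative to `S`; so cross reductions between simply typed terms terminate
(`exists_parallelFormIn_em_of_isNf`). For general parallel forms the channel is first permuted
inwards (`exists_parallelFormIn_em`). For this the strong subformulas of `A` and `¬ A` have to be
in `S`, which is arranged by lowering a bound on the sizes of the prime factors outside `S` one by
one (`ParallelFormIn.lower`). In the end all kinds have their prime factors in `S`
(`exists_parallelFormIn`).

This does not yet give a normal term: the complexity of a channel in a subterm refers to the free
variables of that subterm only, and these may be fewer than those of the whole term, and may become
fewer during the reduction. Therefore `exists_normalForm` is proved by induction on the cardinality
of `S`. After all kinds have been brought into `S`, the term is normalized from the inside outwards;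
a channel that is still active in its own context, which disregards the set `allowed` of formulas,
has a prime factor that is in `S` but not in `allowed`. So `allowed` is strictly smaller than `S`,
and the induction hypothesis applies to this subterm.

Subject reduction (`Reduces.hasType`) transfers the result to natural deduction proofs.
-/

namespace LambdaCL

open Formula Term

/-! ### Renaming, substitution and free variables -/

@[simp] theorem liftRen_zero (ρ : ℕ → ℕ) : liftRen ρ 0 = 0 := rfl
@[simp] theorem liftRen_succ (ρ : ℕ → ℕ) (n : ℕ) : liftRen ρ (n + 1) = ρ n + 1 := rfl
@[simp] theorem liftSubst_zero (σ : ℕ → Term) : liftSubst σ 0 = var 0 := rfl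
@[simp] theorem liftSubst_succ (σ : ℕ → Term) (n : ℕ) :
    liftSubst σ (n + 1) = (σ n).rename Nat.succ := rfl

theorem liftRen_injective {ρ : ℕ → ℕ} (h : Function.Injective ρ) :
    Function.Injective (liftRen ρ) := by
  rintro (_ | m) (_ | n) hmn <;> simp_all
  exact h hmn

@[simp] theorem liftRen_id : liftRen (fun n => n) = fun n => n := by
  funext n; cases n <;> rfl

theorem insertRen_injective : Function.Injective insertRen :=
  liftRen_injective Nat.succ_injective

theorem rename_congr {t : Term} {ρ τ : ℕ → ℕ} (h : ∀ n, t.Free n → ρ n = τ n) :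
    t.rename ρ = t.rename τ := by
  induction t generalizing ρ τ with
  | var n => simp [Term.rename, h n rfl]
  | tt => rfl
  | lam A u ih =>
    simp only [Term.rename]
    rw [ih]
    rintro (_ | n) hn
    · rfl
    · simp [h n hn]
  | app u v ihu ihv | pair u v ihu ihv | par u v ihu ihv =>
    simp only [Term.rename]
    rw [ihu fun n hn => h n (.inl hn), ihv fun n hn => h n (.inr hn)]
  | proj i u ih | efq P u ih =>
    simp only [Term.rename]
    rw [ih fun n hn => h n hn]
  | em A u v ihu ihv =>
    simp only [Term.rename]
    rw [ihu (τ := liftRen τ), ihv (τ := liftRen τ)]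
    · rintro (_ | n) hn
      · rfl
      · simp [h n (.inr hn)]
    · rintro (_ | n) hn
      · rfl
      · simp [h n (.inl hn)]

theorem rename_id (t : Term) : t.rename (fun n => n) = t := by
  induction t <;> simp_all [Term.rename]

theorem rename_rename (t : Term) (ρ τ : ℕ → ℕ) :
    (t.rename ρ).rename τ = t.rename (fun n => τ (ρ n)) := by
  have key : ∀ ρ τ : ℕ → ℕ, (fun n => liftRen τ (liftRen ρ n)) = liftRen fun n => τ (ρ n) := by
    intro ρ τ; funext n; cases n <;> rfl
  induction t generalizing ρ τ <;> simp_all [Term.rename]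

theorem free_rename {t : Term} {ρ : ℕ → ℕ} {n : ℕ} :
    (t.rename ρ).Free n ↔ ∃ m, t.Free m ∧ ρ m = n := by
  have key : ∀ (t : Term) (ρ : ℕ → ℕ) (n : ℕ), (∃ m, t.Free m ∧ liftRen ρ m = n + 1) ↔
      ∃ m, t.Free (m + 1) ∧ ρ m = n := by
    intro t ρ _
    constructor
    · rintro ⟨_ | m, hm, h⟩
      · simp at h
      · exact ⟨m, hm, by simpa using h⟩
    · rintro ⟨m, hm, h⟩
      exact ⟨m + 1, hm, by simpa using h⟩
  induction t generalizing ρ n with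
  | var m => simp [Term.rename, Free]
  | tt => simp [Term.rename, Free]
  | lam A u ih => simp only [Term.rename, Free, ih, key]
  | app u v ihu ihv | pair u v ihu ihv | par u v ihu ihv =>
    simp only [Term.rename, Free, ihu, ihv, or_and_right, exists_or]
  | proj i u ih | efq P u ih => simp only [Term.rename, Free, ih]
  | em A u v ihu ihv =>
    simp only [Term.rename, Free, ihu, ihv, key, or_and_right, exists_or]

theorem free_rename_iff {t : Term} {ρ : ℕ → ℕ} (h : Function.Injective ρ) {n : ℕ} :
    (t.rename ρ).Free (ρ n) ↔ t.Free n := by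
  rw [free_rename]
  exact ⟨fun ⟨m, hm, e⟩ => h e ▸ hm, fun hn => ⟨n, hn, rfl⟩⟩

theorem free_subst {t : Term} {σ : ℕ → Term} {n : ℕ} :
    (t.subst σ).Free n ↔ ∃ m, t.Free m ∧ (σ m).Free n := by
  have key : ∀ (t : Term) (σ : ℕ → Term) (n : ℕ),
      (∃ m, t.Free m ∧ (liftSubst σ m).Free (n + 1)) ↔
      ∃ m, t.Free (m + 1) ∧ (σ m).Free n := by
    intro t σ n
    constructor
    · rintro ⟨_ | m, hm, h⟩
      · simp [Free] at h
      · exact ⟨m, hm, by simpa [free_rename] using h⟩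
    · rintro ⟨m, hm, h⟩
      exact ⟨m + 1, hm, by simpa [free_rename] using h⟩
  induction t generalizing σ n with
  | var m => simp [Term.subst, Free]
  | tt => simp [Term.subst, Free]
  | lam A u ih => simp only [Term.subst, Free, ih, key]
  | app u v ihu ihv | pair u v ihu ihv | par u v ihu ihv =>
    simp only [Term.subst, Free, ihu, ihv, or_and_right, exists_or]
  | proj i u ih | efq P u ih => simp only [Term.subst, Free, ih]
  | em A u v ihu ihv =>
    simp only [Term.subst, Free, ihu, ihv, key, or_and_right, exists_or]

/-- A term all of whose free variables are at least `k` is a weakening by `k` variables. -/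
theorem exists_rename_add {t : Term} {k : ℕ} (h : ∀ n, t.Free n → k ≤ n) :
    ∃ s : Term, t = s.rename (fun n => n + k) := by
  refine ⟨t.rename (fun n => n - k), ?_⟩
  rw [rename_rename]
  conv_lhs => rw [← rename_id t]
  refine rename_congr fun n hn => ?_
  have := h n hn
  omega

theorem exists_rename_succ {t : Term} (h : ¬ t.Free 0) : ∃ s : Term, t = s.rename Nat.succ :=
  exists_rename_add (k := 1) fun _ hn => Nat.one_le_iff_ne_zero.2 fun e => h (e ▸ hn)

theorem not_free_rename_succ (t : Term) : ¬ (t.rename Nat.succ).Free 0 := by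
  simp [free_rename]

theorem isSimple_rename {t : Term} {ρ : ℕ → ℕ} : (t.rename ρ).IsSimple ↔ t.IsSimple := by
  induction t generalizing ρ <;> simp_all [Term.rename, IsSimple]

theorem Term.IsSimple.subst {t : Term} {σ : ℕ → Term} (ht : t.IsSimple) (h : ∀ n, (σ n).IsSimple) :
    (t.subst σ).IsSimple := by
  induction t generalizing σ with
  | lam A u ih =>
    refine ih ht ?_
    rintro (_ | n)
    · trivial
    · exact isSimple_rename.2 (h n)
  | app u v ihu ihv | pair u v ihu ihv => exact ⟨ihu ht.1 h, ihv ht.2 h⟩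
  | proj i u ih | efq P u ih => exact ih ht h
  | var n => exact h n
  | tt => trivial
  | par | em => exact ht.elim

theorem Term.ParallelForm.rename {t : Term} (ht : t.ParallelForm) (ρ : ℕ → ℕ) :
    (t.rename ρ).ParallelForm := by
  induction ht generalizing ρ with
  | simple h => exact .simple (isSimple_rename.2 h)
  | em A _ _ ihu ihv => exact .em A (ihu _) (ihv _)
  | par _ _ ihu ihv => exact .par (ihu _) (ihv _)

theorem free_tuple_var {n : ℕ} : ∀ {l : List ℕ}, (tuple (l.map var)).Free n ↔ n ∈ l
  | [] => by simp [tuple, Free]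
  | [m] => by simp [tuple, Free, eq_comm]
  | m :: k :: l => by
    have := free_tuple_var (n := n) (l := k :: l)
    simp only [List.map_cons] at this
    simp only [List.map_cons, tuple, Free, this, List.mem_cons, eq_comm]

/-! ### Typing -/

/-- Typing is invariant under renaming, provided that the free variables keep their types. -/
theorem hasType_rename_iff {t : Term} {Γ Γ' : List Formula} {ρ : ℕ → ℕ} {A : Formula}
    (h : ∀ n, t.Free n → Γ'[ρ n]? = Γ[n]?) : HasType Γ' (t.rename ρ) A ↔ HasType Γ t A := by
  have lift : ∀ {u : Term} {B : Formula} {Γ Γ' : List Formula} {ρ : ℕ → ℕ},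
      (∀ n, u.Free (n + 1) → Γ'[ρ n]? = Γ[n]?) →
      ∀ n, u.Free n → (B :: Γ')[liftRen ρ n]? = (B :: Γ)[n]? := by
    rintro u B Γ Γ' ρ h (_ | n) hn
    · rfl
    · simpa using h n hn
  induction t generalizing Γ Γ' ρ A with
  | var n =>
    constructor
    · rintro (_ | _); exact .var (by rw [← h n rfl]; assumption)
    · rintro (_ | _); exact .var (by rw [h n rfl]; assumption)
  | tt => constructor <;> · rintro (_ | _); exact .tt
  | lam B u ih =>
    have e := fun A => ih (A := A) (lift (B := B) h)
    constructor
    · rintro (_ | _); exact .lam ((e _).1 (by assumption))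
    · rintro (_ | _); exact .lam ((e _).2 (by assumption))
  | app u v ihu ihv =>
    have eu := fun A => ihu (A := A) fun n hn => h n (.inl hn)
    have ev := fun A => ihv (A := A) fun n hn => h n (.inr hn)
    constructor
    · rintro (_ | _); exact .app ((eu _).1 (by assumption)) ((ev _).1 (by assumption))
    · rintro (_ | _); exact .app ((eu _).2 (by assumption)) ((ev _).2 (by assumption))
  | pair u v ihu ihv =>
    have eu := fun A => ihu (A := A) fun n hn => h n (.inl hn)
    have ev := fun A => ihv (A := A) fun n hn => h n (.inr hn)
    constructor
    · rintro (_ | _); exact .pair ((eu _).1 (by assumption)) ((ev _).1 (by assumption))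
    · rintro (_ | _); exact .pair ((eu _).2 (by assumption)) ((ev _).2 (by assumption))
  | par u v ihu ihv =>
    have eu := fun A => ihu (A := A) fun n hn => h n (.inl hn)
    have ev := fun A => ihv (A := A) fun n hn => h n (.inr hn)
    constructor
    · rintro (_ | _); exact .par ((eu _).1 (by assumption)) ((ev _).1 (by assumption))
    · rintro (_ | _); exact .par ((eu _).2 (by assumption)) ((ev _).2 (by assumption))
  | proj i u ih =>
    have e := fun A => ih (A := A) h
    constructor
    · rintro (_ | _)
      · exact .proj_zero ((e _).1 (by assumption))
      · exact .proj_one ((e _).1 (by assumption))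
    · rintro (_ | _)
      · exact .proj_zero ((e _).2 (by assumption))
      · exact .proj_one ((e _).2 (by assumption))
  | efq P u ih =>
    have e := fun A => ih (A := A) h
    constructor
    · rintro (_ | _); exact .efq (by assumption) (by assumption) ((e _).1 (by assumption))
    · rintro (_ | _); exact .efq (by assumption) (by assumption) ((e _).2 (by assumption))
  | em B u v ihu ihv =>
    have eu := fun A => ihu (A := A) (lift (B := neg B) fun n hn => h n (.inl hn))
    have ev := fun A => ihv (A := A) (lift (B := B) fun n hn => h n (.inr hn))
    constructor
    · rintro (_ | _); exact .em ((eu _).1 (by assumption)) ((ev _).1 (by assumption))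
    · rintro (_ | _); exact .em ((eu _).2 (by assumption)) ((ev _).2 (by assumption))

theorem HasType.rename {t : Term} {Γ Γ' : List Formula} {ρ : ℕ → ℕ} {A : Formula}
    (ht : HasType Γ t A) (h : ∀ n, t.Free n → Γ'[ρ n]? = Γ[n]?) : HasType Γ' (t.rename ρ) A :=
  (hasType_rename_iff h).2 ht

theorem HasType.weaken {t : Term} {Γ : List Formula} {A B : Formula} (ht : HasType Γ t A) :
    HasType (B :: Γ) (t.rename Nat.succ) A := ht.rename fun n _ => by simp

theorem HasType.swap {t : Term} {Γ : List Formula} {A B C : Formula}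
    (ht : HasType (B :: C :: Γ) t A) : HasType (C :: B :: Γ) (t.rename swapRen) A :=
  ht.rename fun n _ => by rcases n with _ | _ | n <;> simp [swapRen]

theorem HasType.insert {t : Term} {Γ : List Formula} {A B C : Formula}
    (ht : HasType (B :: Γ) t A) : HasType (B :: C :: Γ) (t.rename insertRen) A :=
  ht.rename fun n _ => by rcases n with _ | n <;> simp [insertRen]

theorem HasType.subst {t : Term} {Γ Γ' : List Formula} {σ : ℕ → Term} {A : Formula}
    (ht : HasType Γ t A)
    (h : ∀ n B, t.Free n → Γ[n]? = some B → HasType Γ' (σ n) B) : HasType Γ' (t.subst σ) A := by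
  have lift : ∀ {u : Term} {C : Formula} {Γ Γ' : List Formula} {σ : ℕ → Term},
      (∀ n B, u.Free (n + 1) → Γ[n]? = some B → HasType Γ' (σ n) B) →
      ∀ n B, u.Free n → (C :: Γ)[n]? = some B → HasType (C :: Γ') (liftSubst σ n) B := by
    rintro u C Γ Γ' ρ h (_ | n) B hn e
    · exact .var (by simpa using e)
    · exact (h n B hn (by simpa using e)).weaken
  induction ht generalizing Γ' σ with
  | var e => exact h _ _ rfl e
  | tt => exact .tt
  | lam _ ih => exact .lam (ih (lift h))
  | app _ _ ihu ihv =>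
    exact .app (ihu fun n B hn => h n B (.inl hn)) (ihv fun n B hn => h n B (.inr hn))
  | pair _ _ ihu ihv =>
    exact .pair (ihu fun n B hn => h n B (.inl hn)) (ihv fun n B hn => h n B (.inr hn))
  | par _ _ ihu ihv =>
    exact .par (ihu fun n B hn => h n B (.inl hn)) (ihv fun n B hn => h n B (.inr hn))
  | proj_zero _ ih => exact .proj_zero (ih h)
  | proj_one _ ih => exact .proj_one (ih h)
  | efq hP hP' _ ih => exact .efq hP hP' (ih h)
  | em _ _ ihu ihv =>
    exact .em (ihu (lift fun n B hn => h n B (.inl hn)))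
      (ihv (lift fun n B hn => h n B (.inr hn)))

theorem HasType.unique {t : Term} {Γ : List Formula} {A B : Formula}
    (h : HasType Γ t A) (h' : HasType Γ t B) : A = B := by
  induction h generalizing B with
  | var e => cases h' with | var e' => simpa using e.symm.trans e'
  | tt => cases h'; rfl
  | lam _ ih => cases h' with | lam h => rw [ih h]
  | app _ _ ih _ => cases h' with | app h _ => cases ih h; rfl
  | pair _ _ ih ih' => cases h' with | pair h h' => rw [ih h, ih' h']
  | proj_zero _ ih => cases h' with | proj_zero h => cases ih h; rfl
  | proj_one _ ih => cases h' with | proj_one h => cases ih h; rfl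
  | efq => cases h'; rfl
  | par _ _ ih _ => cases h' with | par h _ => exact ih h
  | em _ _ ih _ => cases h' with | em h _ => exact ih h

/-- The formation of a term in a context: the term in the hole has a type, and it may be replaced
by any term of that type, over renamed free variables. -/
theorem hasType_fill {C : Cxt} {s : Term} {Γ : List Formula} {T : Formula}
    (h : HasType Γ (C.fill s) T) : ∃ B, HasType (C.binders ++ Γ) s B ∧
      ∀ (ρ : ℕ → ℕ) (Γ' : List Formula) (s' : Term), (∀ n < Γ.length, Γ'[ρ n]? = Γ[n]?) →
        HasType (C.binders ++ Γ') s' B → HasType Γ' ((C.rename ρ).fill s') T := by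
  have lift : ∀ {Γ Γ' : List Formula} {ρ : ℕ → ℕ} (A : Formula),
      (∀ n < Γ.length, Γ'[ρ n]? = Γ[n]?) →
      ∀ n < (A :: Γ).length, (A :: Γ')[liftRen ρ n]? = (A :: Γ)[n]? := by
    rintro Γ Γ' ρ A h (_ | n) hn
    · rfl
    · simpa using h n (by simpa using hn)
  have bound : ∀ {Γ : List Formula} {t : Term} {A : Formula}, HasType Γ t A →
      ∀ n, t.Free n → n < Γ.length := by
    intro Γ t A h
    induction h with
    | var e => rintro n rfl; exact (List.getElem?_eq_some_iff.1 e).1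
    | tt => exact fun _ h => h.elim
    | lam _ ih => exact fun n hn => by simpa using ih _ hn
    | app _ _ ih ih' | pair _ _ ih ih' | par _ _ ih ih' =>
      exact fun n hn => hn.elim (ih n) (ih' n)
    | proj_zero _ ih | proj_one _ ih | efq _ _ _ ih => exact ih
    | em _ _ ih ih' =>
      exact fun n hn => by simpa using hn.elim (ih _) (ih' _)
  have ren : ∀ {Γ Γ' : List Formula} {t : Term} {A : Formula} {ρ : ℕ → ℕ}, HasType Γ t A →
      (∀ n < Γ.length, Γ'[ρ n]? = Γ[n]?) → HasType Γ' (t.rename ρ) A :=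
    fun h hρ => h.rename fun n hn => hρ n (bound h n hn)
  induction C generalizing Γ T with
  | hole => exact ⟨T, h, fun _ _ _ _ h' => h'⟩
  | lam A C ih =>
    cases h with | lam h =>
    obtain ⟨B, hB, hC⟩ := ih h
    refine ⟨B, by simpa [Cxt.binders] using hB, fun ρ Γ' s' hρ hs => ?_⟩
    exact .lam (hC _ _ _ (lift A hρ) (by simpa [Cxt.binders] using hs))
  | appL C t ih =>
    cases h with | app h h' =>
    obtain ⟨B, hB, hC⟩ := ih h
    exact ⟨B, hB, fun ρ Γ' s' hρ hs => .app (hC _ _ _ hρ hs) (ren h' hρ)⟩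
  | appR t C ih =>
    cases h with | app h h' =>
    obtain ⟨B, hB, hC⟩ := ih h'
    exact ⟨B, hB, fun ρ Γ' s' hρ hs => .app (ren h hρ) (hC _ _ _ hρ hs)⟩
  | pairL C t ih =>
    cases h with | pair h h' =>
    obtain ⟨B, hB, hC⟩ := ih h
    exact ⟨B, hB, fun ρ Γ' s' hρ hs => .pair (hC _ _ _ hρ hs) (ren h' hρ)⟩
  | pairR t C ih =>
    cases h with | pair h h' =>
    obtain ⟨B, hB, hC⟩ := ih h'
    exact ⟨B, hB, fun ρ Γ' s' hρ hs => .pair (ren h hρ) (hC _ _ _ hρ hs)⟩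
  | parL C t ih =>
    cases h with | par h h' =>
    obtain ⟨B, hB, hC⟩ := ih h
    exact ⟨B, hB, fun ρ Γ' s' hρ hs => .par (hC _ _ _ hρ hs) (ren h' hρ)⟩
  | parR t C ih =>
    cases h with | par h h' =>
    obtain ⟨B, hB, hC⟩ := ih h'
    exact ⟨B, hB, fun ρ Γ' s' hρ hs => .par (ren h hρ) (hC _ _ _ hρ hs)⟩
  | proj i C ih =>
    cases h with
    | proj_zero h =>
      obtain ⟨B, hB, hC⟩ := ih h
      exact ⟨B, hB, fun ρ Γ' s' hρ hs => .proj_zero (hC _ _ _ hρ hs)⟩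
    | proj_one h =>
      obtain ⟨B, hB, hC⟩ := ih h
      exact ⟨B, hB, fun ρ Γ' s' hρ hs => .proj_one (hC _ _ _ hρ hs)⟩
  | efq P C ih =>
    cases h with | efq hP hP' h =>
    obtain ⟨B, hB, hC⟩ := ih h
    exact ⟨B, hB, fun ρ Γ' s' hρ hs => .efq hP hP' (hC _ _ _ hρ hs)⟩
  | emL A C t ih =>
    cases h with | em h h' =>
    obtain ⟨B, hB, hC⟩ := ih h
    refine ⟨B, by simpa [Cxt.binders] using hB, fun ρ Γ' s' hρ hs => ?_⟩
    exact .em (hC _ _ _ (lift _ hρ) (by simpa [Cxt.binders] using hs)) (ren h' (lift _ hρ))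
  | emR A t C ih =>
    cases h with | em h h' =>
    obtain ⟨B, hB, hC⟩ := ih h'
    refine ⟨B, by simpa [Cxt.binders] using hB, fun ρ Γ' s' hρ hs => ?_⟩
    exact .em (ren h (lift _ hρ)) (hC _ _ _ (lift _ hρ) (by simpa [Cxt.binders] using hs))

theorem cxt_rename_id (C : Cxt) : C.rename (fun n => n) = C := by
  induction C <;> simp_all [Cxt.rename, rename_id]

theorem hasType_of_mem_components {t s : Term} {Γ : List Formula} {T : Formula}
    (h : HasType Γ t T) (hs : s ∈ t.components) : HasType Γ s T := by
  induction h with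
  | par _ _ ih ih' => exact (List.mem_append.1 hs).elim ih ih'
  | var e => rw [List.mem_singleton.1 hs]; exact .var e
  | tt => rw [List.mem_singleton.1 hs]; exact .tt
  | lam h _ => rw [List.mem_singleton.1 hs]; exact .lam h
  | app h h' _ _ => rw [List.mem_singleton.1 hs]; exact .app h h'
  | pair h h' _ _ => rw [List.mem_singleton.1 hs]; exact .pair h h'
  | proj_zero h _ => rw [List.mem_singleton.1 hs]; exact .proj_zero h
  | proj_one h _ => rw [List.mem_singleton.1 hs]; exact .proj_one h
  | efq hP hP' h _ => rw [List.mem_singleton.1 hs]; exact .efq hP hP' h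
  | em h h' _ _ => rw [List.mem_singleton.1 hs]; exact .em h h'

theorem free_of_mem_components {t s : Term} {n : ℕ} (hs : s ∈ t.components) (h : s.Free n) :
    t.Free n := by
  induction t with
  | par u v ihu ihv => exact (List.mem_append.1 hs).imp ihu ihv
  | _ => rwa [List.mem_singleton.1 hs] at h

theorem hasType_tuple {Γ : List Formula} {f : ℕ → Formula} :
    ∀ {l : List ℕ}, (∀ n ∈ l, Γ[n]? = some (f n)) →
      HasType Γ (tuple (l.map var)) (conj (l.map f))
  | [], _ => .tt
  | [n], h => .var (h n (by simp))
  | n :: m :: l, h =>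
    .pair (.var (h n (by simp)))
      (hasType_tuple (l := m :: l) fun k hk => h k (List.mem_cons_of_mem _ hk))

theorem hasType_projections {Γ : List Formula} : ∀ {l : List Formula} {v : Term},
    HasType Γ v (conj l) → ∀ (i : ℕ) (hi : i < l.length),
      HasType Γ ((projections l.length v).getD i tt) l[i]
  | [], _, _, _, hi => by simp at hi
  | [A], v, h, i, hi => by
    obtain rfl : i = 0 := by simpa using hi
    exact h
  | A :: B :: l, v, h, 0, _ => .proj_zero h
  | A :: B :: l, v, h, i + 1, hi => by
    have := hasType_projections (l := B :: l) (.proj_one h) i (by simpa using hi)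
    simpa [projections] using this

theorem free_projections : ∀ {k : ℕ} {v : Term} {i n : ℕ},
    ((projections k v).getD i tt).Free n → v.Free n
  | 0, _, _, _, h => by simp [projections, Free] at h
  | 1, v, 0, _, h => h
  | 1, v, i + 1, _, h => by simp [projections, Free] at h
  | k + 2, v, 0, _, h => h
  | k + 2, v, i + 1, n, h => by
    have := free_projections (k := k + 1) (v := proj 1 v) (i := i) (n := n)
      (by simpa [projections] using h)
    exact this

/-! ### Reduction steps: congruence, types and free variables -/

/-- Composition of contexts: `D` is put into the hole of `C`. -/
def Cxt.comp : Cxt → Cxt → Cxt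
  | hole, D => D
  | lam A C, D => lam A (comp C D)
  | appL C t, D => appL (comp C D) t
  | appR t C, D => appR t (comp C D)
  | pairL C t, D => pairL (comp C D) t
  | pairR t C, D => pairR t (comp C D)
  | proj i C, D => proj i (comp C D)
  | efq P C, D => efq P (comp C D)
  | parL C t, D => parL (comp C D) t
  | parR t C, D => parR t (comp C D)
  | emL A C t, D => emL A (comp C D) t
  | emR A t C, D => emR A t (comp C D)

theorem Cxt.fill_comp (C D : Cxt) (s : Term) : (C.comp D).fill s = C.fill (D.fill s) := by
  induction C <;> simp_all [comp, fill]

theorem Cxt.binders_comp (C D : Cxt) : (C.comp D).binders = D.binders ++ C.binders := by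
  induction C <;> simp_all [comp, binders]

theorem Step.fill {C : Cxt} {Γ : List Formula} {t t' : Term} (h : Step (C.binders ++ Γ) t t') :
    Step Γ (C.fill t) (C.fill t') := by
  obtain ⟨D, s, s', rfl, rfl, h⟩ := h
  refine ⟨C.comp D, s, s', (C.fill_comp D s).symm, (C.fill_comp D s').symm, ?_⟩
  rwa [Cxt.binders_comp, List.append_assoc]

theorem Reduces.fill {C : Cxt} {Γ : List Formula} {t t' : Term}
    (h : Reduces (C.binders ++ Γ) t t') : Reduces Γ (C.fill t) (C.fill t') :=
  by
  induction h with
  | refl => exact .refl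
  | tail _ h ih => exact ih.tail h.fill

theorem Redex.reduces {Γ : List Formula} {t t' : Term} (h : Redex Γ t t') : Reduces Γ t t' :=
  .single ⟨.hole, t, t', rfl, rfl, h⟩

theorem Reduces.app {Γ : List Formula} {u u' v v' : Term} (h : Reduces Γ u u')
    (h' : Reduces Γ v v') : Reduces Γ (app u v) (app u' v') :=
  .trans (Reduces.fill (C := .appL .hole v) h) (Reduces.fill (C := .appR u' .hole) h')

theorem Reduces.pair {Γ : List Formula} {u u' v v' : Term} (h : Reduces Γ u u')
    (h' : Reduces Γ v v') : Reduces Γ (pair u v) (pair u' v') :=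
  .trans (Reduces.fill (C := .pairL .hole v) h) (Reduces.fill (C := .pairR u' .hole) h')

theorem Reduces.par {Γ : List Formula} {u u' v v' : Term} (h : Reduces Γ u u')
    (h' : Reduces Γ v v') : Reduces Γ (par u v) (par u' v') :=
  .trans (Reduces.fill (C := .parL .hole v) h) (Reduces.fill (C := .parR u' .hole) h')

theorem Reduces.em {Γ : List Formula} {A : Formula} {u u' v v' : Term}
    (h : Reduces (neg A :: Γ) u u') (h' : Reduces (A :: Γ) v v') :
    Reduces Γ (em A u v) (em A u' v') :=
  .trans (Reduces.fill (C := .emL A .hole v) h) (Reduces.fill (C := .emR A u' .hole) h')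

theorem Reduces.lam {Γ : List Formula} {A : Formula} {u u' : Term}
    (h : Reduces (A :: Γ) u u') : Reduces Γ (lam A u) (lam A u') :=
  Reduces.fill (C := .lam A .hole) h

theorem Elim.hasType_plug {Γ : List Formula} {ξ : Elim} {t : Term} {T : Formula}
    (h : HasType Γ (ξ.plug t) T) : ∃ B, HasType Γ t B ∧
      (∀ t', HasType Γ t' B → HasType Γ (ξ.plug t') T) ∧
      ∀ A t', HasType (A :: Γ) t' B → HasType (A :: Γ) (ξ.weaken.plug t') T := by
  cases ξ with
  | arg s =>
    cases h with | app h h' =>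
    exact ⟨_, h, fun _ h => .app h h', fun _ _ h => .app h h'.weaken⟩
  | proj i =>
    cases h with
    | proj_zero h => exact ⟨_, h, fun _ h => .proj_zero h, fun _ _ h => .proj_zero h⟩
    | proj_one h => exact ⟨_, h, fun _ h => .proj_one h, fun _ _ h => .proj_one h⟩
  | efq P =>
    cases h with | efq hP hP' h =>
    exact ⟨_, h, fun _ h => .efq hP hP' h, fun _ _ h => .efq hP hP' h⟩

theorem IntRedex.hasType {Γ : List Formula} {t t' : Term} {T : Formula} (h : IntRedex t t')
    (ht : HasType Γ t T) : HasType Γ t' T := by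
  cases h with
  | beta A u t =>
    cases ht with | app h h' =>
    cases h with | lam h =>
    refine h.subst ?_
    rintro (_ | n) B _ e
    · obtain rfl : A = B := by simpa using e
      exact h'
    · exact .var (by simpa using e)
  | proj_zero u v =>
    cases ht with | proj_zero h =>
    cases h with | pair h _ => exact h
  | proj_one u v =>
    cases ht with | proj_one h =>
    cases h with | pair _ h => exact h

/-- Subject reduction at the root of a term. -/
theorem Redex.hasType {Γ : List Formula} {t t' : Term} {T : Formula} (h : Redex Γ t t')
    (ht : HasType Γ t T) : HasType Γ t' T := by
  cases h with
  | int h => exact h.hasType ht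
  | app_em A w u v =>
    cases ht with | app h h' =>
    cases h' with | em hu hv => exact .em (.app h.weaken hu) (.app h.weaken hv)
  | em_elim A u v ξ =>
    obtain ⟨B, h, -, h'⟩ := Elim.hasType_plug ht
    cases h with | em hu hv => exact .em (h' _ _ hu) (h' _ _ hv)
  | app_par w u v =>
    cases ht with | app h h' =>
    cases h' with | par hu hv => exact .par (.app h hu) (.app h hv)
  | par_elim u v ξ =>
    obtain ⟨B, h, h', -⟩ := Elim.hasType_plug ht
    cases h with | par hu hv => exact .par (h' _ hu) (h' _ hv)
  | lam_em A B u v =>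
    cases ht with | lam h =>
    cases h with | em hu hv => exact .em (.lam hu.swap) (.lam hv.swap)
  | pair_em_left A u v w =>
    cases ht with | pair h h' =>
    cases h with | em hu hv => exact .em (.pair hu h'.weaken) (.pair hv h'.weaken)
  | pair_em_right A u v w =>
    cases ht with | pair h h' =>
    cases h' with | em hu hv => exact .em (.pair h.weaken hu) (.pair h.weaken hv)
  | lam_par A u v =>
    cases ht with | lam h =>
    cases h with | par hu hv => exact .par (.lam hu) (.lam hv)
  | pair_par_left u v w =>
    cases ht with | pair h h' =>
    cases h with | par hu hv => exact .par (.pair hu h') (.pair hv h')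
  | pair_par_right u v w =>
    cases ht with | pair h h' =>
    cases h' with | par hu hv => exact .par (.pair h hu) (.pair h hv)
  | em_em_left A B u v w =>
    cases ht with | em h h' =>
    cases h with | em hu hv => exact .em (.em hu.swap h'.insert) (.em hv.swap h'.insert)
  | em_em_right A B u v w =>
    cases ht with | em h h' =>
    cases h' with | em hu hv => exact .em (.em h.insert hu.swap) (.em h.insert hv.swap)
  | em_par_left B u v w =>
    cases ht with | em h h' =>
    cases h with | par hu hv => exact .par (.em hu h') (.em hv h')
  | em_par_right B u v w =>
    cases ht with | em h h' =>
    cases h' with | par hu hv => exact .par (.em h hu) (.em h hv)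
  | basic_cross A C u D =>
    cases ht with | em h h' =>
    obtain ⟨B, hB, -⟩ := hasType_fill h
    cases hB with | app hB hu =>
    cases hB with | var e =>
    obtain ⟨rfl, rfl⟩ : A = _ ∧ bot = _ := by simpa [Cxt.depth, neg] using e
    have hu : HasType Γ u A := (hasType_rename_iff fun n _ => by
      rw [List.getElem?_append_right (by simp [Cxt.depth]; omega)]
      have : n + (C.depth + 1) - C.binders.length = n + 1 := by simp [Cxt.depth]; omega
      rw [this]; simp).1 hu
    refine h'.subst ?_
    rintro (_ | n) B _ e
    · obtain rfl : A = B := by simpa using e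
      exact hu
    · exact .var (by simpa using e)
  | erase_right A u v =>
    cases ht with | em h _ => exact (hasType_rename_iff fun n _ => by simp).1 h
  | erase_left A u v =>
    cases ht with | em _ h => exact (hasType_rename_iff fun n _ => by simp).1 h
  | cross A L C u D ys _ _ hL hu _ _ _ hys _ =>
    cases ht with | em h h' =>
    obtain ⟨B, hB, hC⟩ := hasType_fill (hasType_of_mem_components h hL)
    cases hB with | app hB hu' =>
    cases hB with | var e =>
    obtain ⟨rfl, rfl⟩ : A = _ ∧ bot = _ := by simpa [Cxt.depth, neg] using e
    refine .em (.em ?_ h'.insert) ?_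
    · refine hC _ _ _ ?_ (.app (A := conj (ys.map fun n => C.binders.getD n top))
        (.var ?_) (hasType_tuple fun n hn => ?_))
      · rintro (_ | n) _ <;> simp [insertRen]
      · rw [List.getElem?_append_right (by simp [Cxt.depth])]
        simp [Cxt.depth, neg]
      · have hn : n < C.binders.length := ((hys n).1 hn).2
        rw [List.getElem?_append_left hn]
        simp [List.getD, hn]
    · refine h'.subst ?_
      rintro (_ | n) B _ e
      · obtain rfl : A = B := by simpa using e
        refine hu'.subst fun n B hn e => ?_
        unfold messageSubst
        split_ifs with hd
        · have hmem : n ∈ ys := (hys n).2 ⟨hn, hd⟩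
          have hi := List.idxOf_lt_length_of_mem hmem
          have := hasType_projections (Γ := conj (ys.map fun n => C.binders.getD n top) :: Γ)
            (l := ys.map fun n => C.binders.getD n top) (v := var 0) (.var rfl)
            (ys.idxOf n) (by simpa using hi)
          have hd' : n < C.binders.length := hd
          rw [List.getElem?_append_left hd'] at e
          simpa [e] using this
        · have hne : n ≠ C.depth := fun e => hu (e ▸ hn)
          obtain ⟨k, rfl⟩ : ∃ k, n = C.depth + 1 + k := ⟨n - (C.depth + 1), by omega⟩
          rw [List.getElem?_append_right (by simp [Cxt.depth]; omega)] at e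
          have h1 : C.depth + 1 + k - C.binders.length = k + 1 := by simp [Cxt.depth]; omega
          have h2 : C.depth + 1 + k - C.depth = k + 1 := by omega
          rw [h1] at e
          rw [h2]
          exact .var (by simpa using e)
      · exact .var (by simpa using e)

theorem Step.hasType {Γ : List Formula} {t t' : Term} {T : Formula} (h : Step Γ t t')
    (ht : HasType Γ t T) : HasType Γ t' T := by
  obtain ⟨C, s, s', rfl, rfl, h⟩ := h
  obtain ⟨B, hs, hC⟩ := hasType_fill ht
  have := hC (fun n => n) Γ s' (fun _ _ => rfl) (h.hasType hs)
  rwa [cxt_rename_id] at this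

/-- Subject reduction. -/
theorem Reduces.hasType {Γ : List Formula} {t t' : Term} {T : Formula} (h : Reduces Γ t t')
    (ht : HasType Γ t T) : HasType Γ t' T := by
  induction h with
  | refl => exact ht
  | tail _ h ih => exact h.hasType ih

theorem free_fill_of_subset {C : Cxt} {s s' : Term} (h : ∀ n, s'.Free n → s.Free n) {n : ℕ}
    (hn : (C.fill s').Free n) : (C.fill s).Free n := by
  induction C generalizing n with
  | hole => exact h n hn
  | lam A C ih | proj i C ih | efq P C ih => exact ih hn
  | appL C t ih | pairL C t ih | parL C t ih | emL A C t ih => exact hn.imp_left ih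
  | appR t C ih | pairR t C ih | parR t C ih | emR A t C ih => exact hn.imp_right ih

theorem free_fill_of_free {C : Cxt} {s : Term} {n : ℕ} (h : s.Free (n + C.depth)) :
    (C.fill s).Free n := by
  induction C generalizing n with
  | hole => exact h
  | lam A C ih =>
    exact ih (by simpa [Cxt.depth, Cxt.binders, Nat.add_assoc, Nat.add_comm] using h)
  | proj i C ih | efq P C ih => exact ih h
  | emL A C t ih =>
    exact .inl (ih (by simpa [Cxt.depth, Cxt.binders, Nat.add_assoc, Nat.add_comm] using h))
  | emR A t C ih =>
    exact .inr (ih (by simpa [Cxt.depth, Cxt.binders, Nat.add_assoc, Nat.add_comm] using h))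
  | appL C t ih | pairL C t ih | parL C t ih => exact .inl (ih h)
  | appR t C ih | pairR t C ih | parR t C ih => exact .inr (ih h)

/-- A free variable of `C` with renamed variables and with `s'` in its hole comes from `s'`, or
from `C` alone, so that it occurs whatever term `s` is put into the hole. -/
theorem free_fill_rename {C : Cxt} {ρ : ℕ → ℕ} {s s' : Term} {k : ℕ}
    (h : ((C.rename ρ).fill s').Free k) :
    s'.Free (k + C.depth) ∨ ∃ m, (C.fill s).Free m ∧ ρ m = k := by
  have lift : ∀ {u : Term} {ρ : ℕ → ℕ} {k : ℕ}, (∃ m, u.Free m ∧ liftRen ρ m = k + 1) →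
      ∃ m, u.Free (m + 1) ∧ ρ m = k := by
    rintro u ρ k ⟨_ | m, hm, e⟩
    · simp at e
    · exact ⟨m, hm, by simpa using e⟩
  have assoc : ∀ C : Cxt, k + 1 + C.depth = k + (C.depth + 1) := fun C => by omega
  induction C generalizing ρ k with
  | hole => exact .inl h
  | lam A C ih =>
    refine (ih h (fun C => by omega)).imp (fun h => ?_) lift
    simpa [Cxt.depth, Cxt.binders, Nat.add_assoc, Nat.add_comm] using h
  | proj i C ih | efq P C ih => exact ih h assoc
  | emL A C t ih =>
    rcases h with h | h
    · refine (ih h (fun C => by omega)).imp (fun h => ?_) fun h => ?_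
      · simpa [Cxt.depth, Cxt.binders, Nat.add_assoc, Nat.add_comm] using h
      · obtain ⟨m, hm, e⟩ := lift h
        exact ⟨m, .inl hm, e⟩
    · obtain ⟨m, hm, e⟩ := lift (free_rename.1 h)
      exact .inr ⟨m, .inr hm, e⟩
  | emR A t C ih =>
    rcases h with h | h
    · obtain ⟨m, hm, e⟩ := lift (free_rename.1 h)
      exact .inr ⟨m, .inl hm, e⟩
    · refine (ih h (fun C => by omega)).imp (fun h => ?_) fun h => ?_
      · simpa [Cxt.depth, Cxt.binders, Nat.add_assoc, Nat.add_comm] using h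
      · obtain ⟨m, hm, e⟩ := lift h
        exact ⟨m, .inr hm, e⟩
  | appL C t ih | pairL C t ih | parL C t ih =>
    rcases h with h | h
    · exact (ih h assoc).imp id fun ⟨m, hm, e⟩ => ⟨m, .inl hm, e⟩
    · obtain ⟨m, hm, e⟩ := free_rename.1 h
      exact .inr ⟨m, .inr hm, e⟩
  | appR t C ih | pairR t C ih | parR t C ih =>
    rcases h with h | h
    · obtain ⟨m, hm, e⟩ := free_rename.1 h
      exact .inr ⟨m, .inl hm, e⟩
    · exact (ih h assoc).imp id fun ⟨m, hm, e⟩ => ⟨m, .inr hm, e⟩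

theorem IntRedex.free {t t' : Term} (h : IntRedex t t') {n : ℕ} (hn : t'.Free n) : t.Free n := by
  cases h with
  | beta A u t =>
    obtain ⟨_ | m, hm, e⟩ := free_subst.1 hn
    · exact .inr e
    · obtain rfl : m = n := e
      exact .inl hm
  | proj_zero u v => exact .inl hn
  | proj_one u v => exact .inr hn

theorem Elim.free_plug {ξ : Elim} {t : Term} {n : ℕ} :
    (ξ.plug t).Free n ↔ t.Free n ∨ (ξ.plug tt).Free n := by
  cases ξ <;> simp [plug, Free]

theorem Elim.free_weaken {ξ : Elim} {n : ℕ} :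
    (ξ.weaken.plug tt).Free (n + 1) ↔ (ξ.plug tt).Free n := by
  cases ξ <;> simp [plug, weaken, Free, free_rename]

theorem free_rename_swapRen {t : Term} {n : ℕ} :
    (t.rename swapRen).Free (n + 2) ↔ t.Free (n + 2) := by
  refine free_rename.trans ⟨?_, fun h => ⟨n + 2, h, rfl⟩⟩
  rintro ⟨_ | _ | m, hm, e⟩ <;> simp [swapRen] at e
  exact e ▸ hm

theorem free_rename_insertRen {t : Term} {n : ℕ} :
    (t.rename insertRen).Free (n + 2) ↔ t.Free (n + 1) :=
  free_rename_iff (ρ := insertRen) insertRen_injective (n := n + 1)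

/-- Reduction at the root of a term creates no new free variables. -/
theorem Redex.free {Γ : List Formula} {t t' : Term} (h : Redex Γ t t') {n : ℕ}
    (hn : t'.Free n) : t.Free n := by
  cases h with
  | int h => exact h.free hn
  | em_elim A u v ξ =>
    simp only [Free] at hn
    rw [Elim.free_plug, Elim.free_weaken, Elim.free_plug (t := v), Elim.free_weaken] at hn
    rw [Elim.free_plug]
    simp only [Free]
    tauto
  | par_elim u v ξ =>
    simp only [Free] at hn
    rw [Elim.free_plug, Elim.free_plug (t := v)] at hn
    rw [Elim.free_plug]
    simp only [Free]
    tauto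
  | basic_cross A C u D =>
    obtain ⟨_ | m, hm, e⟩ := free_subst.1 hn
    · refine .inl (free_fill_of_free (.inr (free_rename.2 ⟨n, e, ?_⟩)))
      omega
    · obtain rfl : m = n := e
      exact .inr hm
  | erase_right A u v => exact .inl (free_rename.2 ⟨n, hn, rfl⟩)
  | erase_left A u v => exact .inr (free_rename.2 ⟨n, hn, rfl⟩)
  | cross A L C u D ys _ _ hL hu _ _ _ hys _ =>
    rcases hn with (hn | hn) | hn
    · rcases free_fill_rename (s := app (var C.depth) u) hn with h | ⟨_ | m, hm, e⟩
      · rcases h with h | h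
        · simp [Free] at h; omega
        · have := ((hys _).1 (free_tuple_var.1 h)).2
          omega
      · simp [insertRen] at e
      · obtain rfl : m = n := by simpa [insertRen] using e
        exact .inl (free_of_mem_components hL hm)
    · exact .inr (free_rename_insertRen.1 hn)
    · obtain ⟨_ | m, hm, e⟩ := free_subst.1 hn
      · obtain ⟨k, hk, e⟩ := free_subst.1 e
        unfold messageSubst at e
        split_ifs at e with hd
        · simpa [Free] using free_projections e
        · refine .inl (free_of_mem_components hL (free_fill_of_free (.inr ?_)))
          have hne : k ≠ C.depth := fun e => hu (e ▸ hk)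
          simp only [Free] at e
          obtain rfl : k = n + 1 + C.depth := by omega
          exact hk
      · obtain rfl : m = n := by simpa [Free] using e
        exact .inr hm
  | _ =>
    simp only [Free, Nat.add_assoc, Nat.reduceAdd, free_rename_swapRen, free_rename_insertRen,
      free_rename_iff Nat.succ_injective] at hn ⊢
    tauto

theorem Step.free {Γ : List Formula} {t t' : Term} (h : Step Γ t t') {n : ℕ}
    (hn : t'.Free n) : t.Free n := by
  obtain ⟨C, s, s', rfl, rfl, h⟩ := h
  exact free_fill_of_subset (fun _ => h.free) hn

theorem Reduces.free {Γ : List Formula} {t t' : Term} (h : Reduces Γ t t') {n : ℕ}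
    (hn : t'.Free n) : t.Free n := by
  induction h with
  | refl => exact hn
  | tail _ h ih => exact ih (h.free hn)

/-! ### Composition of substitutions -/

theorem subst_congr {t : Term} {σ τ : ℕ → Term} (h : ∀ n, σ n = τ n) : t.subst σ = t.subst τ := by
  rw [funext h]

theorem subst_rename (t : Term) (ρ : ℕ → ℕ) (σ : ℕ → Term) :
    (t.rename ρ).subst σ = t.subst fun n => σ (ρ n) := by
  have key : ∀ (ρ : ℕ → ℕ) (σ : ℕ → Term),
      (fun n => liftSubst σ (liftRen ρ n)) = liftSubst fun n => σ (ρ n) := by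
    intro ρ σ; funext n; cases n <;> rfl
  induction t generalizing ρ σ <;> simp_all [Term.rename, Term.subst]

theorem rename_subst (t : Term) (σ : ℕ → Term) (ρ : ℕ → ℕ) :
    (t.subst σ).rename ρ = t.subst fun n => (σ n).rename ρ := by
  have key : ∀ (σ : ℕ → Term) (ρ : ℕ → ℕ),
      (fun n => (liftSubst σ n).rename (liftRen ρ)) = liftSubst fun n => (σ n).rename ρ := by
    intro σ ρ; funext n
    cases n <;> simp [rename_rename, Term.rename]
  induction t generalizing σ ρ <;> simp_all [Term.rename, Term.subst]

theorem subst_subst (t : Term) (σ τ : ℕ → Term) :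
    (t.subst σ).subst τ = t.subst fun n => (σ n).subst τ := by
  have key : ∀ σ τ : ℕ → Term,
      (fun n => (liftSubst σ n).subst (liftSubst τ)) = liftSubst fun n => (σ n).subst τ := by
    intro σ τ; funext n
    cases n <;> simp [subst_rename, rename_subst, Term.subst]
  induction t generalizing σ τ <;> simp_all [Term.subst]

theorem subst_var (t : Term) : t.subst var = t := by
  have key : liftSubst var = var := by
    funext n; cases n <;> rfl
  induction t <;> simp_all [Term.subst]

theorem rename_inst (u t : Term) (ρ : ℕ → ℕ) :
    (u.inst t).rename ρ = (u.rename (liftRen ρ)).inst (t.rename ρ) := by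
  unfold inst
  rw [rename_subst, subst_rename]
  refine subst_congr ?_
  rintro (_ | n) <;> rfl

theorem inst_subst_liftSubst (u t : Term) (σ : ℕ → Term) :
    (u.subst (liftSubst σ)).inst t = u.subst (fun | 0 => t | n + 1 => σ n) := by
  unfold inst
  rw [subst_subst]
  refine subst_congr ?_
  rintro (_ | n)
  · rfl
  · simp [subst_rename, subst_var]

/-! ### Weak normalization of simply typed terms -/

/-- Contraction of an intuitionistic redex anywhere in a term. -/
def IntStep (t t' : Term) : Prop :=
  ∃ (C : Cxt) (s s' : Term), t = C.fill s ∧ t' = C.fill s' ∧ IntRedex s s'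

/-- Finite sequences of intuitionistic reductions. -/
def IntReduces : Term → Term → Prop := Relation.ReflTransGen IntStep

theorem IntStep.fill (C : Cxt) {t t' : Term} (h : IntStep t t') :
    IntStep (C.fill t) (C.fill t') := by
  obtain ⟨D, s, s', rfl, rfl, h⟩ := h
  exact ⟨C.comp D, s, s', (C.fill_comp D s).symm, (C.fill_comp D s').symm, h⟩

theorem IntReduces.fill (C : Cxt) {t t' : Term} (h : IntReduces t t') :
    IntReduces (C.fill t) (C.fill t') := by
  induction h with
  | refl => exact .refl
  | tail _ h ih => exact ih.tail (h.fill C)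

theorem IntReduces.reduces {Γ : List Formula} {t t' : Term} (h : IntReduces t t') :
    Reduces Γ t t' := by
  induction h with
  | refl => exact .refl
  | tail _ h ih =>
    obtain ⟨C, s, s', rfl, rfl, h⟩ := h
    exact ih.tail ⟨C, s, s', rfl, rfl, .int h⟩

theorem IntRedex.rename {t t' : Term} (h : IntRedex t t') (ρ : ℕ → ℕ) :
    IntRedex (t.rename ρ) (t'.rename ρ) := by
  cases h with
  | beta A u t => rw [rename_inst]; exact .beta _ _ _
  | proj_zero u v => exact .proj_zero _ _
  | proj_one u v => exact .proj_one _ _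

theorem IntStep.rename {t t' : Term} (h : IntStep t t') (ρ : ℕ → ℕ) :
    IntStep (t.rename ρ) (t'.rename ρ) := by
  obtain ⟨C, s, s', rfl, rfl, h⟩ := h
  induction C generalizing ρ with
  | hole => exact ⟨.hole, _, _, rfl, rfl, h.rename ρ⟩
  | lam A C ih => exact (ih (liftRen ρ)).fill (.lam A .hole)
  | appL C t ih => exact (ih ρ).fill (.appL .hole (t.rename ρ))
  | appR t C ih => exact (ih ρ).fill (.appR (t.rename ρ) .hole)
  | pairL C t ih => exact (ih ρ).fill (.pairL .hole (t.rename ρ))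
  | pairR t C ih => exact (ih ρ).fill (.pairR (t.rename ρ) .hole)
  | proj i C ih => exact (ih ρ).fill (.proj i .hole)
  | efq P C ih => exact (ih ρ).fill (.efq P .hole)
  | parL C t ih => exact (ih ρ).fill (.parL .hole (t.rename ρ))
  | parR t C ih => exact (ih ρ).fill (.parR (t.rename ρ) .hole)
  | emL A C t ih => exact (ih (liftRen ρ)).fill (.emL A .hole (t.rename (liftRen ρ)))
  | emR A t C ih => exact (ih (liftRen ρ)).fill (.emR A (t.rename (liftRen ρ)) .hole)

theorem IntReduces.rename {t t' : Term} (h : IntReduces t t') (ρ : ℕ → ℕ) :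
    IntReduces (t.rename ρ) (t'.rename ρ) := by
  induction h with
  | refl => exact .refl
  | tail _ h ih => exact ih.tail (h.rename ρ)

theorem isSimple_fill_of_isSimple {C : Cxt} {s s' : Term} (h : (C.fill s).IsSimple)
    (hs : s'.IsSimple) : (C.fill s').IsSimple := by
  induction C <;> simp_all [Cxt.fill, IsSimple]

theorem IntReduces.isSimple {t t' : Term} (h : IntReduces t t') (ht : t.IsSimple) :
    t'.IsSimple := by
  induction h with
  | refl => exact ht
  | tail _ h ih =>
    obtain ⟨C, s, s', rfl, rfl, h⟩ := h
    have hs := isSimple_of_fill C s ih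
    refine isSimple_fill_of_isSimple ih ?_
    cases h with
    | beta A u t =>
      refine IsSimple.subst (t := u) hs.1 ?_
      rintro (_ | n)
      · exact hs.2
      · trivial
    | proj_zero u v => exact hs.1
    | proj_one u v => exact hs.2

/-- The terms that are introductions of an implication or of a conjunction. -/
def IsIntro : Term → Prop
  | lam _ _ => True
  | pair _ _ => True
  | _ => False

/-- Intuitionistic normality, by recursion on the term: nothing that is eliminated is an
introduction. For untyped terms this is a little stronger than `IntNormal`. -/
def IsNf : Term → Prop
  | var _ => True
  | tt => True
  | lam _ u => IsNf u
  | app u v => IsNf u ∧ IsNf v ∧ ¬ IsIntro u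
  | pair u v => IsNf u ∧ IsNf v
  | proj _ u => IsNf u ∧ ¬ IsIntro u
  | efq _ u => IsNf u
  | par u v => IsNf u ∧ IsNf v
  | .em _ u v => IsNf u ∧ IsNf v

theorem isIntro_rename {t : Term} {ρ : ℕ → ℕ} : IsIntro (t.rename ρ) ↔ IsIntro t := by
  cases t <;> simp [Term.rename, IsIntro]

theorem isNf_rename {t : Term} {ρ : ℕ → ℕ} : IsNf (t.rename ρ) ↔ IsNf t := by
  induction t generalizing ρ <;> simp_all [Term.rename, IsNf, isIntro_rename]

theorem isNf_of_fill {C : Cxt} {s : Term} (h : IsNf (C.fill s)) : IsNf s := by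
  induction C <;> simp_all [Cxt.fill, IsNf]

theorem IsNf.intNormal {t : Term} (h : IsNf t) : IntNormal t := by
  rintro C s s' rfl hs
  have h := isNf_of_fill h
  cases hs <;> simp [IsNf, IsIntro] at h

/-- Reducibility to a normal form. -/
def Normalizes (t : Term) : Prop := ∃ t', IntReduces t t' ∧ IsNf t'

theorem Normalizes.fill_of_isNf {t : Term} {C : Cxt} (h : Normalizes t)
    (hC : ∀ t', IsNf t' → IsNf (C.fill t')) : Normalizes (C.fill t) := by
  obtain ⟨t', h, h'⟩ := h
  exact ⟨_, h.fill C, hC t' h'⟩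

/-- Reducibility candidates for weak normalization. The clause for implications quantifies over
renamings, so that the predicates are closed under weakening, and normalizability is put into
every clause, so that it need not be extracted from the behaviour under eliminations. -/
def Computable : Formula → Term → Prop
  | imp A B, t => Normalizes t ∧
      ∀ (ρ : ℕ → ℕ) (u : Term), Computable A u → Computable B (app (t.rename ρ) u)
  | .and A B, t => Normalizes t ∧ Computable A (proj 0 t) ∧ Computable B (proj 1 t)
  | _, t => Normalizes t

theorem Computable.normalizes {A : Formula} {t : Term} (h : Computable A t) : Normalizes t := by
  cases A with
  | imp A B => exact h.1
  | and A B => exact h.1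
  | _ => exact h

theorem Normalizes.rename {t : Term} (h : Normalizes t) (ρ : ℕ → ℕ) :
    Normalizes (t.rename ρ) := by
  obtain ⟨t', h, h'⟩ := h
  exact ⟨_, h.rename ρ, isNf_rename.2 h'⟩

theorem Computable.rename {A : Formula} {t : Term} (h : Computable A t) (ρ : ℕ → ℕ) :
    Computable A (t.rename ρ) := by
  induction A generalizing t with
  | imp A B _ _ =>
    refine ⟨h.1.rename ρ, fun τ u hu => ?_⟩
    rw [rename_rename]
    exact h.2 _ u hu
  | and A B ihA ihB => exact ⟨h.1.rename ρ, ihA h.2.1, ihB h.2.2⟩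
  | _ => exact Normalizes.rename h ρ

theorem Computable.expand {A : Formula} {t t' : Term} (h : IntReduces t t')
    (ht : Computable A t') : Computable A t := by
  have wn : Normalizes t := by
    obtain ⟨s, hs, hs'⟩ := ht.normalizes
    exact ⟨s, .trans h hs, hs'⟩
  induction A generalizing t t' with
  | imp A B _ ihB =>
    refine ⟨wn, fun ρ u hu => ?_⟩
    have hr := (h.rename ρ).fill (.appL .hole u)
    have hc := ht.2 ρ u hu
    obtain ⟨s, hs, hs'⟩ := hc.normalizes
    exact ihB hr hc ⟨s, .trans hr hs, hs'⟩
  | and A B ihA ihB =>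
    have h0 := h.fill (.proj 0 .hole)
    have h1 := h.fill (.proj 1 .hole)
    obtain ⟨s, hs, hs'⟩ := ht.2.1.normalizes
    obtain ⟨r, hr, hr'⟩ := ht.2.2.normalizes
    exact ⟨wn, ihA h0 ht.2.1 ⟨s, .trans h0 hs, hs'⟩, ihB h1 ht.2.2 ⟨r, .trans h1 hr, hr'⟩⟩
  | _ => exact wn

/-- Normal terms that can be eliminated without creating a redex are computable. -/
theorem Computable.of_isNf {A : Formula} {t : Term} (h : IsNf t) (h' : ¬ IsIntro t) :
    Computable A t := by
  induction A generalizing t with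
  | imp A B _ ihB =>
    refine ⟨⟨t, .refl, h⟩, fun ρ u hu => ?_⟩
    obtain ⟨u', hr, hu'⟩ := hu.normalizes
    refine .expand (hr.fill (.appR (t.rename ρ) .hole)) (ihB ?_ id)
    exact ⟨isNf_rename.2 h, hu', isIntro_rename.not.2 h'⟩
  | and A B ihA ihB => exact ⟨⟨t, .refl, h⟩, ihA ⟨h, h'⟩ id, ihB ⟨h, h'⟩ id⟩
  | _ => exact ⟨t, .refl, h⟩

theorem IntRedex.intReduces {t t' : Term} (h : IntRedex t t') : IntReduces t t' :=
  .single ⟨.hole, t, t', rfl, rfl, h⟩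

/-- The fundamental lemma of the candidates. -/
theorem HasType.computable {Γ : List Formula} {t : Term} {A : Formula} (h : HasType Γ t A)
    (hs : t.IsSimple) {σ : ℕ → Term} (hσ : ∀ n B, Γ[n]? = some B → Computable B (σ n)) :
    Computable A (t.subst σ) := by
  induction h generalizing σ with
  | var e => exact hσ _ _ e
  | tt => exact ⟨Term.tt, .refl, trivial⟩
  | @lam Γ A B u _ ih =>
    constructor
    · refine Normalizes.fill_of_isNf (C := .lam A .hole) ?_ fun _ h => h
      refine (ih hs ?_).normalizes
      rintro (_ | n) B e
      · exact .of_isNf trivial id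
      · exact (hσ n B (by simpa using e)).rename _
    · intro ρ v hv
      refine .expand (IntRedex.beta _ _ _).intReduces ?_
      rw [rename_subst]
      have key : (fun n => (liftSubst σ n).rename (liftRen ρ)) =
          liftSubst fun n => (σ n).rename ρ := by
        funext n
        cases n <;> simp [rename_rename, Term.rename]
      rw [key, inst_subst_liftSubst]
      refine ih hs ?_
      rintro (_ | n) B e
      · obtain rfl : A = B := by simpa using e
        exact hv
      · exact (hσ n B (by simpa using e)).rename _
  | app _ _ ihu ihv =>
    have := (ihu hs.1 hσ).2 (fun n => n) _ (ihv hs.2 hσ)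
    rwa [rename_id] at this
  | @pair Γ A B u v _ _ ihu ihv =>
    have hu := ihu hs.1 hσ
    have hv := ihv hs.2 hσ
    obtain ⟨u', hru, hu'⟩ := hu.normalizes
    obtain ⟨v', hrv, hv'⟩ := hv.normalizes
    refine ⟨⟨Term.pair u' v', ?_, hu', hv'⟩, ?_, ?_⟩
    · exact .trans (hru.fill (.pairL .hole _)) (hrv.fill (.pairR _ .hole))
    · exact .expand (IntRedex.proj_zero _ _).intReduces hu
    · exact .expand (IntRedex.proj_one _ _).intReduces hv
  | proj_zero _ ih => exact (ih hs hσ).2.1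
  | proj_one _ ih => exact (ih hs hσ).2.2
  | @efq Γ P u hP _ _ ih =>
    have hn : Normalizes (Term.efq P (u.subst σ)) :=
      (ih hs hσ).normalizes.fill_of_isNf (C := .efq P .hole) fun _ h => h
    cases P with
    | and | imp => exact hP.elim
    | _ => exact hn
  | par | em => exact hs.elim

/-- Simply typed terms have normal forms. -/
theorem exists_isNf_of_isSimple {Γ : List Formula} {t : Term} {A : Formula} (h : HasType Γ t A)
    (hs : t.IsSimple) : ∃ t', Reduces Γ t t' ∧ t'.IsSimple ∧ IsNf t' := by
  have := (h.computable hs (σ := var) fun n B _ => .of_isNf trivial id).normalizes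
  rw [subst_var] at this
  obtain ⟨t', hr, ht'⟩ := this
  exact ⟨t', hr.reduces, hr.isSimple hs, ht'⟩

/-! ### Reduction to parallel form -/

theorem exists_parallelForm_lam {u : Term} (hu : u.ParallelForm) (Γ : List Formula) (A : Formula)
    (ρ : ℕ → ℕ) : ∃ t, Reduces Γ (lam A (u.rename ρ)) t ∧ t.ParallelForm := by
  induction hu generalizing Γ ρ with
  | simple h => exact ⟨_, .refl, .simple (isSimple_rename.2 h)⟩
  | @em B u v _ _ ihu ihv =>
    obtain ⟨u', hu, hu'⟩ := ihu (neg B :: Γ) fun n => swapRen (liftRen ρ n)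
    obtain ⟨v', hv, hv'⟩ := ihv (B :: Γ) fun n => swapRen (liftRen ρ n)
    rw [← rename_rename] at hu hv
    exact ⟨_, .trans (Redex.lam_em A B _ _).reduces (hu.em hv), .em B hu' hv'⟩
  | @par u v _ _ ihu ihv =>
    obtain ⟨u', hu, hu'⟩ := ihu Γ ρ
    obtain ⟨v', hv, hv'⟩ := ihv Γ ρ
    exact ⟨_, .trans (Redex.lam_par A _ _).reduces (hu.par hv), .par hu' hv'⟩

/-- The condition on `ξ` says that its argument, if it has one, is simply typed. -/
theorem exists_parallelForm_elim {u : Term} (hu : u.ParallelForm) (Γ : List Formula) (ξ : Elim)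
    (hξ : (ξ.plug tt).IsSimple) : ∃ t, Reduces Γ (ξ.plug u) t ∧ t.ParallelForm := by
  induction hu generalizing Γ ξ with
  | simple h =>
    refine ⟨_, .refl, .simple ?_⟩
    cases ξ with
    | arg s => exact ⟨h, hξ.2⟩
    | proj i => exact h
    | efq P => exact h
  | @em B u v _ _ ihu ihv =>
    have hw : (ξ.weaken.plug tt).IsSimple := by
      cases ξ with
      | arg s => exact ⟨trivial, isSimple_rename.2 hξ.2⟩
      | proj i => trivial
      | efq P => trivial
    obtain ⟨u', hu, hu'⟩ := ihu (neg B :: Γ) _ hw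
    obtain ⟨v', hv, hv'⟩ := ihv (B :: Γ) _ hw
    exact ⟨_, .trans (Redex.em_elim B _ _ ξ).reduces (hu.em hv), .em B hu' hv'⟩
  | @par u v _ _ ihu ihv =>
    obtain ⟨u', hu, hu'⟩ := ihu Γ ξ hξ
    obtain ⟨v', hv, hv'⟩ := ihv Γ ξ hξ
    exact ⟨_, .trans (Redex.par_elim _ _ ξ).reduces (hu.par hv), .par hu' hv'⟩

theorem exists_parallelForm_app {u v : Term} (hu : u.ParallelForm) (hv : v.ParallelForm)
    (Γ : List Formula) : ∃ t, Reduces Γ (app u v) t ∧ t.ParallelForm := by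
  induction hv generalizing Γ u with
  | @simple v hv => exact exists_parallelForm_elim hu Γ (.arg v) ⟨trivial, hv⟩
  | @em B v w _ _ ihv ihw =>
    obtain ⟨v', hv, hv'⟩ := ihv (hu.rename _) (neg B :: Γ)
    obtain ⟨w', hw, hw'⟩ := ihw (hu.rename _) (B :: Γ)
    exact ⟨_, .trans (Redex.app_em B _ _ _).reduces (hv.em hw), .em B hv' hw'⟩
  | @par v w _ _ ihv ihw =>
    obtain ⟨v', hv, hv'⟩ := ihv hu Γ
    obtain ⟨w', hw, hw'⟩ := ihw hu Γ
    exact ⟨_, .trans (Redex.app_par _ _ _).reduces (hv.par hw), .par hv' hw'⟩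

theorem exists_parallelForm_pair_isSimple {u v : Term} (hu : u.ParallelForm) (hv : v.IsSimple)
    (Γ : List Formula) : ∃ t, Reduces Γ (pair u v) t ∧ t.ParallelForm := by
  induction hu generalizing Γ v with
  | simple hu => exact ⟨_, .refl, .simple ⟨hu, hv⟩⟩
  | @em B u w _ _ ihu ihw =>
    obtain ⟨u', hu, hu'⟩ := ihu (isSimple_rename.2 hv) (neg B :: Γ)
    obtain ⟨w', hw, hw'⟩ := ihw (isSimple_rename.2 hv) (B :: Γ)
    exact ⟨_, .trans (Redex.pair_em_left B _ _ _).reduces (hu.em hw), .em B hu' hw'⟩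
  | @par u w _ _ ihu ihw =>
    obtain ⟨u', hu, hu'⟩ := ihu hv Γ
    obtain ⟨w', hw, hw'⟩ := ihw hv Γ
    exact ⟨_, .trans (Redex.pair_par_left _ _ _).reduces (hu.par hw), .par hu' hw'⟩

theorem exists_parallelForm_pair {u v : Term} (hu : u.ParallelForm) (hv : v.ParallelForm)
    (Γ : List Formula) : ∃ t, Reduces Γ (pair u v) t ∧ t.ParallelForm := by
  induction hv generalizing Γ u with
  | simple hv => exact exists_parallelForm_pair_isSimple hu hv Γ
  | @em B v w _ _ ihv ihw =>
    obtain ⟨v', hv, hv'⟩ := ihv (hu.rename _) (neg B :: Γ)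
    obtain ⟨w', hw, hw'⟩ := ihw (hu.rename _) (B :: Γ)
    exact ⟨_, .trans (Redex.pair_em_right B _ _ _).reduces (hv.em hw), .em B hv' hw'⟩
  | @par v w _ _ ihv ihw =>
    obtain ⟨v', hv, hv'⟩ := ihv hu Γ
    obtain ⟨w', hw, hw'⟩ := ihw hu Γ
    exact ⟨_, .trans (Redex.pair_par_right _ _ _).reduces (hv.par hw), .par hv' hw'⟩

theorem exists_parallelForm (t : Term) (Γ : List Formula) :
    ∃ t', Reduces Γ t t' ∧ t'.ParallelForm := by
  induction t generalizing Γ with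
  | var n => exact ⟨_, .refl, .simple trivial⟩
  | tt => exact ⟨_, .refl, .simple trivial⟩
  | lam A u ih =>
    obtain ⟨u', hr, hu⟩ := ih (A :: Γ)
    obtain ⟨t, ht, ht'⟩ := exists_parallelForm_lam hu Γ A fun n => n
    rw [rename_id] at ht
    exact ⟨t, .trans hr.lam ht, ht'⟩
  | app u v ihu ihv =>
    obtain ⟨u', hr, hu⟩ := ihu Γ
    obtain ⟨v', hr', hv⟩ := ihv Γ
    obtain ⟨t, ht, ht'⟩ := exists_parallelForm_app hu hv Γ
    exact ⟨t, .trans (hr.app hr') ht, ht'⟩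
  | pair u v ihu ihv =>
    obtain ⟨u', hr, hu⟩ := ihu Γ
    obtain ⟨v', hr', hv⟩ := ihv Γ
    obtain ⟨t, ht, ht'⟩ := exists_parallelForm_pair hu hv Γ
    exact ⟨t, .trans (hr.pair hr') ht, ht'⟩
  | proj i u ih =>
    obtain ⟨u', hr, hu⟩ := ih Γ
    obtain ⟨t, ht, ht'⟩ := exists_parallelForm_elim hu Γ (.proj i) trivial
    exact ⟨t, .trans (Reduces.fill (C := .proj i .hole) hr) ht, ht'⟩
  | efq P u ih =>
    obtain ⟨u', hr, hu⟩ := ih Γ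
    obtain ⟨t, ht, ht'⟩ := exists_parallelForm_elim hu Γ (.efq P) trivial
    exact ⟨t, .trans (Reduces.fill (C := .efq P .hole) hr) ht, ht'⟩
  | par u v ihu ihv =>
    obtain ⟨u', hr, hu⟩ := ihu Γ
    obtain ⟨v', hr', hv⟩ := ihv Γ
    exact ⟨_, hr.par hr', .par hu hv⟩
  | em A u v ihu ihv =>
    obtain ⟨u', hr, hu⟩ := ihu (neg A :: Γ)
    obtain ⟨v', hr', hv⟩ := ihv (A :: Γ)
    exact ⟨_, hr.em hr', .em A hu hv⟩

/-! ### Subformulas -/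

namespace Formula

theorem size_pos (A : Formula) : 0 < A.size := by
  cases A <;> simp [size]

theorem Subformula.eq_or_size_lt {A B : Formula} (h : Subformula B A) :
    B = A ∨ B.size < A.size := by
  induction h with
  | refl => exact .inl rfl
  | and_left _ _ ih | and_right _ _ ih | imp_left _ _ ih | imp_right _ _ ih =>
    right
    rcases ih with rfl | ih <;> simp only [size] <;> omega

theorem Subformula.size_le {A B : Formula} (h : Subformula B A) : B.size ≤ A.size := by
  rcases h.eq_or_size_lt with rfl | h <;> omega

theorem properSubformula_iff {A B : Formula} :
    ProperSubformula B A ↔ Subformula B A ∧ B.size < A.size := by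
  constructor
  · rintro ⟨h, h'⟩
    exact ⟨h, h.eq_or_size_lt.resolve_left h'⟩
  · rintro ⟨h, h'⟩
    exact ⟨h, by rintro rfl; omega⟩

theorem Subformula.trans {A B C : Formula} (h : Subformula A B) (h' : Subformula B C) :
    Subformula A C := by
  induction h' with
  | refl => exact h
  | and_left _ _ ih => exact .and_left _ ih
  | and_right _ _ ih => exact .and_right _ ih
  | imp_left _ _ ih => exact .imp_left _ ih
  | imp_right _ _ ih => exact .imp_right _ ih

theorem ProperSubformula.trans_subformula {A B C : Formula} (h : ProperSubformula A B)
    (h' : Subformula B C) : ProperSubformula A C := by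
  rw [properSubformula_iff] at h ⊢
  exact ⟨h.1.trans h', h.2.trans_le h'.size_le⟩

theorem Subformula.properSubformula_imp_left {A B C : Formula} (h : Subformula A B) :
    ProperSubformula A (imp B C) :=
  properSubformula_iff.2 ⟨.imp_left _ h, by have := h.size_le; simp only [size]; omega⟩

theorem not_properSubformula_of_isAtomic {P Q : Formula} (h : P.IsAtomic) :
    ¬ ProperSubformula Q P := by
  rintro ⟨h', hne⟩
  cases h' with
  | refl => exact hne rfl
  | and_left | and_right | imp_left | imp_right => exact h

theorem isPrime_of_mem_primeFactors {P A : Formula} (h : P ∈ A.primeFactors) : IsPrime P := by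
  induction A with
  | and A B ihA ihB => exact (List.mem_append.1 h).elim ihA ihB
  | _ =>
    rw [List.mem_singleton.1 h]
    rintro B C ⟨⟩

theorem subformula_of_mem_primeFactors {P A : Formula} (h : P ∈ A.primeFactors) :
    Subformula P A := by
  induction A with
  | and A B ihA ihB =>
    exact (List.mem_append.1 h).elim (fun h => .and_left _ (ihA h)) fun h => .and_right _ (ihB h)
  | _ =>
    rw [List.mem_singleton.1 h]
    exact .refl _

theorem exists_mem_primeFactors {C A : Formula} (hC : IsPrime C) (h : Subformula C A) :
    ∃ P ∈ A.primeFactors, Subformula C P := by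
  induction A with
  | and A B ihA ihB =>
    cases h with
    | refl => exact (hC A B rfl).elim
    | and_left _ h =>
      obtain ⟨P, hP, h⟩ := ihA h
      exact ⟨P, List.mem_append.2 (.inl hP), h⟩
    | and_right _ h =>
      obtain ⟨P, hP, h⟩ := ihB h
      exact ⟨P, List.mem_append.2 (.inr hP), h⟩
  | _ => exact ⟨_, List.mem_singleton.2 rfl, h⟩

theorem finite_setOf_subformula (A : Formula) : {B | Subformula B A}.Finite := by
  induction A with
  | and A B ihA ihB =>
    refine ((ihA.union ihB).insert (and A B)).subset ?_
    intro C h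
    cases h with
    | refl => exact .inl rfl
    | and_left _ h => exact .inr (.inl h)
    | and_right _ h => exact .inr (.inr h)
  | imp A B ihA ihB =>
    refine ((ihA.union ihB).insert (imp A B)).subset ?_
    intro C h
    cases h with
    | refl => exact .inl rfl
    | imp_left _ h => exact .inr (.inl h)
    | imp_right _ h => exact .inr (.inr h)
  | _ =>
    refine Set.Subsingleton.finite ?_
    rintro B (_ | _) C (_ | _)
    rfl

end Formula

/-! ### Sets of harmless formulas

A set `S` of formulas, closed under proper subformulas, plays the role of the formulas that may be
used without violating the subformula property. -/

/-- Closure under proper subformulas. -/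
def SubClosed (S : Set Formula) : Prop := ∀ P ∈ S, ∀ Q, ProperSubformula Q P → Q ∈ S

/-- All prime factors of `A` are in `S`: a channel of kind `A` has complexity `0` relative to
`S`. -/
def FactorsIn (S : Set Formula) (A : Formula) : Prop := ∀ P ∈ A.primeFactors, P ∈ S

/-- All strong subformulas of `A` are in `S`: a free variable of type `A` adds no formula
to `S`. -/
def StrongIn (S : Set Formula) (A : Formula) : Prop := ∀ Q, StrongSubformula Q A → Q ∈ S

/-- All proper subformulas of prime factors of `A` are in `S`: a term introduced at the type `A`
adds no formula to `S`. -/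
def ProperIn (S : Set Formula) (A : Formula) : Prop :=
  ∀ P ∈ A.primeFactors, ∀ Q, ProperSubformula Q P → Q ∈ S

theorem FactorsIn.properIn {S : Set Formula} {A : Formula} (hS : SubClosed S)
    (h : FactorsIn S A) : ProperIn S A := fun P hP => hS P (h P hP)

theorem StrongIn.of_subformula {S : Set Formula} {A B : Formula} (h : StrongIn S A)
    (hB : Subformula B A) : StrongIn S B :=
  fun Q ⟨C, hC, hCB, hQ⟩ => h Q ⟨C, hC, hCB.trans_subformula hB, hQ⟩

theorem ProperIn.mem_of_subformula {S : Set Formula} {A C Q : Formula} (h : ProperIn S A)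
    (hC : IsPrime C) (hCA : Subformula C A) (hQ : ProperSubformula Q C) : Q ∈ S := by
  obtain ⟨P, hP, hCP⟩ := exists_mem_primeFactors hC hCA
  exact h P hP Q (hQ.trans_subformula hCP)

theorem ProperIn.strongIn {S : Set Formula} {A : Formula} (h : ProperIn S A) : StrongIn S A :=
  fun _ ⟨_, hC, hCA, hQ⟩ => h.mem_of_subformula hC hCA.1 hQ

theorem ProperIn.strongIn_neg {S : Set Formula} {A : Formula} (h : ProperIn S A) :
    StrongIn S (neg A) := by
  rintro Q ⟨C, hC, ⟨hCA, hne⟩, hQ⟩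
  cases hCA with
  | refl => exact (hne rfl).elim
  | imp_left _ hCA => exact h.mem_of_subformula hC hCA hQ
  | imp_right _ hCA =>
    exact (not_properSubformula_of_isAtomic (P := bot) trivial (hQ.trans_subformula hCA)).elim

theorem properIn_of_isAtomic {S : Set Formula} {P : Formula} (h : P.IsAtomic) :
    ProperIn S P := by
  cases P with
  | and | imp => exact h.elim
  | _ =>
    intro P hP Q hQ
    rw [List.mem_singleton.1 hP] at hQ
    exact (not_properSubformula_of_isAtomic h hQ).elim

theorem StrongIn.properIn_left {S : Set Formula} {A B : Formula} (h : StrongIn S (imp A B)) :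
    ProperIn S A := fun P hP Q hQ =>
  h Q ⟨P, isPrime_of_mem_primeFactors hP,
    (subformula_of_mem_primeFactors hP).properSubformula_imp_left, hQ⟩

theorem ProperIn.factorsIn_left {S : Set Formula} {A B : Formula} (h : ProperIn S (imp A B)) :
    FactorsIn S A := fun _ hP =>
  h _ (List.mem_singleton.2 rfl) _ (subformula_of_mem_primeFactors hP).properSubformula_imp_left

theorem ProperIn.properIn_right {S : Set Formula} {A B : Formula} (h : ProperIn S (imp A B)) :
    ProperIn S B := fun _ hP Q hQ =>
  h _ (List.mem_singleton.2 rfl) Q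
    (hQ.trans_subformula (.imp_right _ (subformula_of_mem_primeFactors hP)))

theorem properIn_of_forall {S : Set Formula} {A : Formula}
    (h : ∀ Q, ProperSubformula Q A → Q ∈ S) : ProperIn S A := fun _ hP Q hQ =>
  h Q (hQ.trans_subformula (subformula_of_mem_primeFactors hP))

theorem factorsIn_conj {S : Set Formula} {f : ℕ → Formula} : ∀ {l : List ℕ}, l ≠ [] →
    (∀ n ∈ l, FactorsIn S (f n)) → FactorsIn S (conj (l.map f))
  | [], h, _ => (h rfl).elim
  | [n], _, h => h n (by simp)
  | n :: m :: l, _, h => fun P hP => (List.mem_append.1 hP).elim (h n (by simp) P)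
    (factorsIn_conj (l := m :: l) (by simp) (fun k hk => h k (List.mem_cons_of_mem _ hk)) P)

/-- The types of the free variables add no formula to `S`. -/
def FreeStrongIn (S : Set Formula) (Γ : List Formula) (t : Term) : Prop :=
  ∀ n X, t.Free n → Γ[n]? = some X → StrongIn S X

theorem FreeStrongIn.mono {S : Set Formula} {Γ : List Formula} {t t' : Term}
    (h : FreeStrongIn S Γ t) (h' : ∀ n, t'.Free n → t.Free n) : FreeStrongIn S Γ t' :=
  fun n X hn => h n X (h' n hn)

theorem Reduces.freeStrongIn {S : Set Formula} {Γ : List Formula} {t t' : Term}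
    (h : Reduces Γ t t') (ht : FreeStrongIn S Γ t) : FreeStrongIn S Γ t' :=
  ht.mono fun _ => h.free

theorem FreeStrongIn.lam {S : Set Formula} {Γ : List Formula} {A : Formula} {u : Term}
    (h : FreeStrongIn S Γ (lam A u)) {B : Formula} (hB : StrongIn S B) :
    FreeStrongIn S (B :: Γ) u := by
  rintro (_ | n) X hn e
  · obtain rfl : B = X := by simpa using e
    exact hB
  · exact h n X hn (by simpa using e)

theorem FreeStrongIn.em_left {S : Set Formula} {Γ : List Formula} {A : Formula} {u v : Term}
    (h : FreeStrongIn S Γ (em A u v)) (hA : ProperIn S A) : FreeStrongIn S (neg A :: Γ) u :=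
  FreeStrongIn.lam (A := A) (h.mono fun _ => .inl) hA.strongIn_neg

theorem FreeStrongIn.em_right {S : Set Formula} {Γ : List Formula} {A : Formula} {u v : Term}
    (h : FreeStrongIn S Γ (em A u v)) (hA : ProperIn S A) : FreeStrongIn S (A :: Γ) v :=
  FreeStrongIn.lam (A := A) (h.mono fun _ => .inr) hA.strongIn

/-! ### The subformula property of simply typed normal terms -/

/-- The type of a normal term that is not an introduction is, up to `⊤` and atoms, a subformula of
the type of its head variable. -/
theorem IsNf.strongIn {S : Set Formula} {Γ : List Formula} {t : Term} {T : Formula}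
    (ht : IsNf t) (h : HasType Γ t T) (hs : t.IsSimple) (hi : ¬ IsIntro t)
    (hΓ : FreeStrongIn S Γ t) : StrongIn S T := by
  induction h with
  | var e => exact hΓ _ _ rfl e
  | tt => exact (properIn_of_isAtomic (P := top) trivial).strongIn
  | lam | pair => exact (hi trivial).elim
  | app _ _ ih _ =>
    exact (ih ht.1 hs.1 ht.2.2 (hΓ.mono fun _ => .inl)).of_subformula (.imp_right _ (.refl _))
  | proj_zero _ ih => exact (ih ht.1 hs ht.2 hΓ).of_subformula (.and_left _ (.refl _))
  | proj_one _ ih => exact (ih ht.1 hs ht.2 hΓ).of_subformula (.and_right _ (.refl _))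
  | efq hP => exact (properIn_of_isAtomic hP).strongIn
  | par | em => exact hs.elim

/-- If the kind `A` of a channel has a prime factor outside `S`, then, in a simply typed normal
term whose type and free variables add no formula to `S`, the rightmost occurrence of the channel
is applied to a message, and the variables bound above the message have types with all prime
factors in `S`. The induction has two modes, for terms whose type adds no formula to `S` and for
terms that are going to be eliminated. -/
theorem exists_message {S : Set Formula} (hS : SubClosed S) {A : Formula} (hA : ¬ FactorsIn S A)
    {Γ : List Formula} {s : Term} {T : Formula} {i : ℕ} (h : HasType Γ s T) (hs : s.IsSimple)
    (hn : IsNf s) (hΓ : FreeStrongIn S Γ s) (hi : Γ[i]? = some (neg A)) (hf : s.Free i)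
    (hm : ProperIn S T ∨ ¬ IsIntro s ∧ s ≠ var i) :
    ∃ (C : Cxt) (m : Term), s = C.fill (app (var (i + C.depth)) m) ∧ ¬ m.Free (i + C.depth) ∧
      ¬ C.FreeRight i ∧ ∀ B ∈ C.binders, FactorsIn S B := by
  induction h generalizing i with
  | var e =>
    obtain rfl : _ = i := hf
    rcases hm with hm | hm
    · rw [hi] at e
      obtain rfl := Option.some.inj e
      -- an occurrence that is not applied would put all prime factors of `A` into `S`
      exact (hA hm.factorsIn_left).elim
    · exact (hm.2 rfl).elim
  | tt => exact hf.elim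
  | @lam Γ D E u _ ih =>
    have hm := hm.resolve_right fun h => h.1 trivial
    have hD := hm.factorsIn_left
    obtain ⟨C, m, rfl, hm, hr, hB⟩ := ih hs hn (hΓ.lam (hD.properIn hS).strongIn)
      (i := i + 1) (by simpa using hi) hf (.inl hm.properIn_right)
    have e : i + 1 + C.depth = i + (Cxt.lam D C).depth := by
      simp [Cxt.depth, Cxt.binders, Nat.add_assoc, Nat.add_comm]
    refine ⟨.lam D C, m, ?_, e ▸ hm, hr, fun B h => ?_⟩
    · rw [← e]; rfl
    · rcases List.mem_append.1 h with h | h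
      · exact hB B h
      · rw [List.mem_singleton.1 h]; exact hD
  | @app Γ D E f m hf' _ ihf ihm =>
    -- the search goes into the argument first, because the rightmost occurrence is wanted
    by_cases hmf : m.Free i
    · have hD := (hn.1.strongIn hf' hs.1 hn.2.2 (hΓ.mono fun _ => .inl)).properIn_left
      obtain ⟨C, m', rfl, h⟩ := ihm hs.2 hn.2.1 (hΓ.mono fun _ => .inr) hi hmf (.inl hD)
      exact ⟨.appR f C, m', rfl, h⟩
    · by_cases hfi : f = var i
      · subst hfi
        exact ⟨.hole, m, rfl, hmf, id, by simp [Cxt.binders]⟩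
      · obtain ⟨C, m', rfl, h, h', h''⟩ := ihf hs.1 hn.1 (hΓ.mono fun _ => .inl) hi
          (hf.resolve_right hmf) (.inr ⟨hn.2.2, hfi⟩)
        exact ⟨.appL C m, m', rfl, h, fun hr => hr.elim h' hmf, h''⟩
  | @pair Γ D E u v _ _ ihu ihv =>
    have hm := hm.resolve_right fun h => h.1 trivial
    by_cases hvf : v.Free i
    · obtain ⟨C, m', rfl, h⟩ := ihv hs.2 hn.2 (hΓ.mono fun _ => .inr) hi hvf
        (.inl fun P hP => hm P (List.mem_append.2 (.inr hP)))
      exact ⟨.pairR u C, m', rfl, h⟩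
    · obtain ⟨C, m', rfl, h, h', h''⟩ := ihu hs.1 hn.1 (hΓ.mono fun _ => .inl) hi
        (hf.resolve_right hvf) (.inl fun P hP => hm P (List.mem_append.2 (.inl hP)))
      exact ⟨.pairL C v, m', rfl, h, fun hr => hr.elim h' hvf, h''⟩
  | @proj_zero Γ D E u h ih =>
    have hu : u ≠ var i := by
      rintro rfl
      cases h with | var e =>
      rw [hi] at e
      cases Option.some.inj e
    obtain ⟨C, m', rfl, hC⟩ := ih hs hn.1 hΓ hi hf (.inr ⟨hn.2, hu⟩)
    exact ⟨.proj 0 C, m', rfl, hC⟩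
  | @proj_one Γ D E u h ih =>
    have hu : u ≠ var i := by
      rintro rfl
      cases h with | var e =>
      rw [hi] at e
      cases Option.some.inj e
    obtain ⟨C, m', rfl, hC⟩ := ih hs hn.1 hΓ hi hf (.inr ⟨hn.2, hu⟩)
    exact ⟨.proj 1 C, m', rfl, hC⟩
  | @efq Γ P u _ _ _ ih =>
    obtain ⟨C, m', rfl, h⟩ := ih hs hn hΓ hi hf (.inl (properIn_of_isAtomic (P := bot) trivial))
    exact ⟨.efq P C, m', rfl, h⟩
  | par | em => exact hs.elim

/-! ### Communication complexity relative to a set of formulas -/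

/-- The formulas that `commComplexity` disregards for a term `t` of type `T` with free variables
typed by `Γ`. -/
def allowed (Γ : List Formula) (T : Formula) (t : Term) : Set Formula :=
  {P | ProperSubformula P T ∨
    ∃ (n : ℕ) (C : Formula), t.Free n ∧ Γ[n]? = some C ∧ StrongSubformula P C}

theorem subClosed_allowed (Γ : List Formula) (T : Formula) (t : Term) :
    SubClosed (allowed Γ T t) := by
  rintro P (hP | ⟨n, C, hn, hC, D, hD, hDC, hP⟩) Q hQ
  · exact .inl (hQ.trans_subformula hP.1)
  · exact .inr ⟨n, C, hn, hC, D, hD, hDC, hQ.trans_subformula hP.1⟩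

theorem finite_allowed (Γ : List Formula) (T : Formula) (t : Term) :
    (allowed Γ T t).Finite := by
  have hΓ : (⋃ C ∈ {C | C ∈ Γ}, {B | Subformula B C}).Finite :=
    (List.finite_toSet Γ).biUnion fun C _ => finite_setOf_subformula C
  refine ((finite_setOf_subformula T).union hΓ).subset ?_
  rintro P (hP | ⟨n, C, hn, hC, D, hD, hDC, hP⟩)
  · exact .inl hP.1
  · exact .inr (Set.mem_biUnion (List.mem_of_getElem? hC) (hP.1.trans hDC.1))

theorem allowed_subset {S : Set Formula} {Γ : List Formula} {T : Formula} {t : Term}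
    (hT : ∀ Q, ProperSubformula Q T → Q ∈ S) (hΓ : FreeStrongIn S Γ t) : allowed Γ T t ⊆ S := by
  rintro P (hP | ⟨n, C, hn, hC, hP⟩)
  · exact hT P hP
  · exact hΓ n C hn hC P hP

theorem nonempty_of_sSup_pos {s : Set ℕ} (h : 0 < sSup s) : s.Nonempty := by
  rw [Set.nonempty_iff_ne_empty]
  rintro rfl
  simp at h

/-- A channel is active if and only if it occurs on both sides and a prime factor of its kind is
not disregarded. -/
theorem active_iff {Γ : List Formula} {A T : Formula} {u v : Term}
    (h : HasType Γ (em A u v) T) :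
    Active Γ A u v ↔ u.Free 0 ∧ v.Free 0 ∧ ¬ FactorsIn (allowed Γ T (em A u v)) A := by
  have key : 0 < commComplexity Γ T A u v ↔ ¬ FactorsIn (allowed Γ T (em A u v)) A := by
    constructor
    · intro hc hA
      obtain ⟨k, P, hP, hPT, hPΓ, -⟩ := nonempty_of_sSup_pos hc
      rcases hA P hP with h | ⟨n, C, hn, hC, h⟩
      · exact hPT h
      · exact hPΓ n C hn hC h
    · intro hA
      simp only [FactorsIn, not_forall] at hA
      obtain ⟨P, hP, hA⟩ := hA
      refine P.size_pos.trans_le (le_csSup ⟨A.size, ?_⟩ ?_)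
      · rintro k ⟨Q, hQ, -, -, rfl⟩
        exact (subformula_of_mem_primeFactors hQ).size_le
      · exact ⟨P, hP, fun h => hA (.inl h), fun n C hn hC h => hA (.inr ⟨n, C, hn, hC, h⟩), rfl⟩
  refine and_congr_right fun _ => and_congr_right fun _ => ?_
  rw [← key]
  exact ⟨fun ⟨T', hT', h'⟩ => hT'.unique h ▸ h', fun h' => ⟨T, h, h'⟩⟩

theorem active_of_not_factorsIn {S : Set Formula} {Γ : List Formula} {A T : Formula} {u v : Term}
    (h : HasType Γ (em A u v) T) (hT : ∀ Q, ProperSubformula Q T → Q ∈ S)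
    (hΓ : FreeStrongIn S Γ (em A u v)) (hA : ¬ FactorsIn S A) (hu : u.Free 0) (hv : v.Free 0) :
    Active Γ A u v :=
  (active_iff h).2 ⟨hu, hv, fun h => hA fun P hP => allowed_subset hT hΓ (h P hP)⟩

/-! ### Cross reductions between simply typed terms -/

/-- The number of occurrences of a free variable. -/
def count : Term → ℕ → ℕ
  | var m, n => if m = n then 1 else 0
  | tt, _ => 0
  | lam _ u, n => count u (n + 1)
  | app u v, n => count u n + count v n
  | pair u v, n => count u n + count v n
  | proj _ u, n => count u n
  | efq _ u, n => count u n
  | par u v, n => count u n + count v n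
  | .em _ u v, n => count u (n + 1) + count v (n + 1)

theorem count_eq_zero {t : Term} {n : ℕ} (h : ¬ t.Free n) : count t n = 0 := by
  induction t generalizing n <;> simp_all [count, Free]

theorem count_rename {t : Term} {ρ : ℕ → ℕ} (hρ : Function.Injective ρ) (n : ℕ) :
    count (t.rename ρ) (ρ n) = count t n := by
  induction t generalizing ρ n with
  | var m => simp [Term.rename, count, hρ.eq_iff]
  | lam A u ih => exact ih (liftRen_injective hρ) (n + 1)
  | em A u v ihu ihv =>
    exact congrArg₂ (· + ·) (ihu (liftRen_injective hρ) (n + 1)) (ihv (liftRen_injective hρ) (n + 1))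
  | _ => simp_all [Term.rename, count]

/-- The number of occurrences when the term in a hole is replaced, over renamed variables. -/
theorem count_fill_rename {C : Cxt} {ρ : ℕ → ℕ} (hρ : Function.Injective ρ) (s s' : Term)
    (n : ℕ) : count ((C.rename ρ).fill s') (ρ n) + count s (n + C.depth) =
      count (C.fill s) n + count s' (ρ n + C.depth) := by
  have lift : ∀ (k : ℕ) (C : Cxt) (A : Formula),
      k + (C.binders ++ [A]).length = k + 1 + C.depth := fun k C A => by
    simp [Cxt.depth]; omega
  induction C generalizing ρ n with
  | hole => simp [Cxt.depth, Cxt.binders, Cxt.rename, Cxt.fill, Nat.add_comm]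
  | lam A C ih =>
    have := ih (liftRen_injective hρ) (n + 1)
    simp only [Cxt.depth, Cxt.binders, lift, Cxt.rename, Cxt.fill, count]
    exact this
  | emL A C t ih =>
    have := ih (liftRen_injective hρ) (n + 1)
    have ht := count_rename (t := t) (liftRen_injective hρ) (n + 1)
    simp only [liftRen_succ] at this ht
    have e₁ := lift n C
    have e₂ := lift (ρ n) C
    simp only [Cxt.rename, Cxt.fill, count]
    rw [Cxt.depth, Cxt.binders, e₁, e₂]
    omega
  | emR A t C ih =>
    have := ih (liftRen_injective hρ) (n + 1)
    have ht := count_rename (t := t) (liftRen_injective hρ) (n + 1)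
    simp only [liftRen_succ] at this ht
    have e₁ := lift n C
    have e₂ := lift (ρ n) C
    simp only [Cxt.rename, Cxt.fill, count]
    rw [Cxt.depth, Cxt.binders, e₁, e₂]
    omega
  | proj i C ih | efq P C ih => exact ih hρ n
  | appL C t ih | appR t C ih | pairL C t ih | pairR t C ih | parL C t ih | parR t C ih =>
    have := ih hρ n
    have ht := count_rename (t := t) hρ n
    simp only [Cxt.depth, Cxt.binders, Cxt.rename, Cxt.fill, count] at this ⊢
    omega

theorem isSimple_fill_rename {C : Cxt} {ρ : ℕ → ℕ} {s s' : Term} (h : (C.fill s).IsSimple)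
    (hs : s'.IsSimple) : ((C.rename ρ).fill s').IsSimple := by
  induction C generalizing ρ <;> simp_all [Cxt.fill, Cxt.rename, IsSimple, isSimple_rename]

theorem isNf_fill_rename {C : Cxt} {ρ : ℕ → ℕ} {f m f' m' : Term}
    (h : IsNf (C.fill (app f m))) (h' : IsNf (app f' m')) :
    IsNf ((C.rename ρ).fill (app f' m')) := by
  have intro_iff : ∀ (C : Cxt) (ρ : ℕ → ℕ),
      IsIntro ((C.rename ρ).fill (app f' m')) ↔ IsIntro (C.fill (app f m)) := by
    intro C ρ
    cases C <;> simp [Cxt.fill, Cxt.rename, IsIntro]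
  induction C generalizing ρ <;>
    simp_all [Cxt.fill, Cxt.rename, IsNf, isNf_rename, isIntro_rename]

theorem isSimple_tuple_var : ∀ l : List ℕ, (tuple (l.map var)).IsSimple
  | [] => trivial
  | [_] => trivial
  | _ :: m :: l => ⟨trivial, isSimple_tuple_var (m :: l)⟩

theorem isNf_tuple_var : ∀ l : List ℕ, IsNf (tuple (l.map var))
  | [] => trivial
  | [_] => trivial
  | _ :: m :: l => ⟨trivial, isNf_tuple_var (m :: l)⟩

theorem isSimple_projections : ∀ (k : ℕ) (v : Term), v.IsSimple → ∀ i,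
    ((projections k v).getD i tt).IsSimple
  | 0, _, _, _ => trivial
  | 1, _, h, 0 => h
  | 1, _, _, _ + 1 => trivial
  | _ + 2, _, h, 0 => h
  | k + 2, v, h, i + 1 => isSimple_projections (k + 1) (proj 1 v) h i

theorem mem_components_of_isSimple {t : Term} (h : t.IsSimple) : t ∈ t.components := by
  cases t <;> simp_all [components, IsSimple]

/-- Parallel forms all of whose communication kinds have their prime factors in `S`. -/
inductive ParallelFormIn (S : Set Formula) : Term → Prop
  | simple {t : Term} : t.IsSimple → ParallelFormIn S t
  | em {A : Formula} {u v : Term} : FactorsIn S A → ParallelFormIn S u → ParallelFormIn S v →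
      ParallelFormIn S (em A u v)
  | par {u v : Term} : ParallelFormIn S u → ParallelFormIn S v → ParallelFormIn S (par u v)

theorem parallelFormIn_rename {S : Set Formula} {t : Term} {ρ : ℕ → ℕ} :
    ParallelFormIn S (t.rename ρ) ↔ ParallelFormIn S t := by
  induction t generalizing ρ with
  | em A u v ihu ihv =>
    constructor
    · rintro (h | ⟨hA, hu, hv⟩)
      · exact h.elim
      · exact .em hA (ihu.1 hu) (ihv.1 hv)
    · rintro (h | ⟨hA, hu, hv⟩)
      · exact h.elim
      · exact .em hA (ihu.2 hu) (ihv.2 hv)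
  | par u v ihu ihv =>
    constructor
    · rintro (h | _ | ⟨hu, hv⟩)
      · exact h.elim
      · exact .par (ihu.1 hu) (ihv.1 hv)
    · rintro (h | _ | ⟨hu, hv⟩)
      · exact h.elim
      · exact .par (ihu.2 hu) (ihv.2 hv)
  | _ =>
    constructor
    · rintro (h | _)
      exact .simple (isSimple_rename.1 h)
    · rintro (h | _)
      exact .simple (isSimple_rename.2 h)

/-- If a channel does not occur on both sides, then the operator is erased. -/
theorem exists_parallelFormIn_of_not_free {S : Set Formula} {Γ : List Formula} {A : Formula}
    {u v : Term} (hu : ParallelFormIn S u) (hv : ParallelFormIn S v)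
    (h : ¬ (u.Free 0 ∧ v.Free 0)) :
    ∃ t, Reduces Γ (em A u v) t ∧ ParallelFormIn S t := by
  by_cases hu0 : u.Free 0
  · obtain ⟨v, rfl⟩ := exists_rename_succ fun hv0 => h ⟨hu0, hv0⟩
    exact ⟨v, (Redex.erase_left A u v).reduces, parallelFormIn_rename.1 hv⟩
  · obtain ⟨u, rfl⟩ := exists_rename_succ hu0
    exact ⟨u, (Redex.erase_right A u v).reduces, parallelFormIn_rename.1 hu⟩

/-- Exhaustive cross reduction of two simply typed terms: each cross reduction removes an
occurrence of the channel from the sender, and the kinds of the channels that it creates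
have their prime factors in `S`. -/
theorem exists_parallelFormIn_em_of_isNf {S : Set Formula} (hS : SubClosed S) {A T : Formula}
    (hT : ∀ Q, ProperSubformula Q T → Q ∈ S) (hA : ProperIn S A) (hA' : ¬ FactorsIn S A)
    {Γ : List Formula} {s r : Term} (h : HasType Γ (em A s r) T)
    (hΓ : FreeStrongIn S Γ (em A s r)) (hs : s.IsSimple) (hr : r.IsSimple) (hn : IsNf s) :
    ∃ t, Reduces Γ (em A s r) t ∧ ParallelFormIn S t := by
  classical
  induction hk : count s 0 using Nat.strong_induction_on generalizing Γ s r with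
  | _ k ih =>
  by_cases hfree : s.Free 0 ∧ r.Free 0
  swap
  · exact exists_parallelFormIn_of_not_free (.simple hs) (.simple hr) hfree
  have hact := active_of_not_factorsIn h hT hΓ hA' hfree.1 hfree.2
  obtain ⟨C, m, rfl, hm, hC, hB⟩ : ∃ (C : Cxt) (m : Term),
      s = C.fill (app (var C.depth) m) ∧ ¬ m.Free C.depth ∧ ¬ C.FreeRight 0 ∧
      ∀ B ∈ C.binders, FactorsIn S B := by
    cases h with | em h _ =>
    simpa only [Nat.zero_add] using exists_message hS hA' h hs hn (hΓ.em_left hA) rfl hfree.1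
      (.inl (properIn_of_forall hT))
  have hms : m.IsSimple := (isSimple_of_fill _ _ hs).2
  set ys := (List.range C.depth).filter fun n => m.Free n with hys
  have mem_ys : ∀ n, n ∈ ys ↔ m.Free n ∧ n < C.depth := fun n => by simp [hys, and_comm]
  -- `ys` lists the variables of the message that are bound by `C`; if there are none, the cross
  -- reduction is a basic one
  by_cases hne : ys = []
  · obtain ⟨m, rfl⟩ : ∃ m' : Term, m = m'.rename fun n => n + (C.depth + 1) := by
      refine exists_rename_add fun n hn => ?_
      have h1 : n ≠ C.depth := fun e => hm (e ▸ hn)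
      have h2 : ¬ n < C.depth := fun hlt => by
        have := (mem_ys n).2 ⟨hn, hlt⟩
        simp [hne] at this
      omega
    refine ⟨r.inst m, (Redex.basic_cross A C m r hact).reduces, .simple ?_⟩
    refine hr.subst ?_
    rintro (_ | n)
    · exact isSimple_rename.1 hms
    · trivial
  · -- the channel created by the cross reduction has the type of a conjunction of variables bound
    -- by `C`, hence a kind with all prime factors in `S`
    have hred := Redex.cross A _ C m r ys (IsSimple.isSimpleParallel hs) hn.intNormal
      (mem_components_of_isSimple hs) hm hC hne (List.nodup_range.filter _) mem_ys hact
    have hfac : FactorsIn S (conj (ys.map fun n => C.binders.getD n top)) := by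
      refine factorsIn_conj hne fun n hn => hB _ ?_
      have hlt : n < C.binders.length := ((mem_ys n).1 hn).2
      simp [List.getD, hlt]
    have htype := hred.hasType h
    have hfree' := hΓ.mono fun _ => hred.free
    have hcount := count_fill_rename (C := C) insertRen_injective (app (var C.depth) m)
      (app (var (C.depth + 1)) (tuple (ys.map var))) 0
    have hzero : count (tuple (ys.map var)) C.depth = 0 :=
      count_eq_zero fun h => absurd ((mem_ys _).1 (free_tuple_var.1 h)).2 (lt_irrefl _)
    have e0 : insertRen 0 = 0 := rfl
    simp only [e0, count, Nat.zero_add, hzero, if_true, Nat.succ_ne_self, if_false,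
      Nat.add_zero] at hcount
    cases htype with | em hl hr' =>
    obtain ⟨t, ht, ht'⟩ := ih _ (by omega) hl (hfree'.em_left (hfac.properIn hS))
      (isSimple_fill_rename hs ⟨trivial, isSimple_tuple_var ys⟩) (isSimple_rename.2 hr)
      (isNf_fill_rename hn ⟨trivial, isNf_tuple_var ys, id⟩) rfl
    refine ⟨_, .trans hred.reduces (ht.em .refl), .em hfac ht' (.simple ?_)⟩
    refine hr.subst ?_
    rintro (_ | n)
    · refine hms.subst fun n => ?_
      unfold messageSubst
      split_ifs
      · exact isSimple_projections _ (var 0) trivial _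
      · trivial
    · trivial

/-! ### Lowering the communication complexity -/

/-- A channel whose complexity relative to `S` is positive is removed from above a simply typed
sender: it is permuted into the receiver, and then cross reductions are carried out. -/
theorem exists_parallelFormIn_em_of_isSimple {S : Set Formula} (hS : SubClosed S) {A T : Formula}
    (hT : ∀ Q, ProperSubformula Q T → Q ∈ S) (hA : ProperIn S A) (hA' : ¬ FactorsIn S A)
    {Γ : List Formula} {s v : Term} (hs : s.IsSimple) (hv : ParallelFormIn S v) (ρ : ℕ → ℕ)
    (h : HasType Γ (em A s (v.rename ρ)) T) (hΓ : FreeStrongIn S Γ (em A s (v.rename ρ))) :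
    ∃ t, Reduces Γ (em A s (v.rename ρ)) t ∧ ParallelFormIn S t := by
  induction hv generalizing Γ s ρ with
  | @simple v hv =>
    obtain ⟨s', hr, hs', hn⟩ : ∃ s', Reduces (neg A :: Γ) s s' ∧ s'.IsSimple ∧ IsNf s' := by
      cases h with | em h _ => exact exists_isNf_of_isSimple h hs
    have hr' := hr.em (.refl (a := v.rename ρ))
    obtain ⟨t, ht, ht'⟩ := exists_parallelFormIn_em_of_isNf hS hT hA hA' (hr'.hasType h)
      (hr'.freeStrongIn hΓ) hs' (isSimple_rename.2 hv) hn
    exact ⟨t, .trans hr' ht, ht'⟩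
  | @em B v w hB hv hw ihv ihw =>
    by_cases hfree : s.Free 0 ∧ ((em B v w).rename ρ).Free 0
    swap
    · exact exists_parallelFormIn_of_not_free (.simple hs)
        (parallelFormIn_rename.2 (.em hB hv hw)) hfree
    have hred := Redex.em_em_right B A _ _ _
      (active_of_not_factorsIn h hT hΓ hA' hfree.1 hfree.2)
    have htype := hred.hasType h
    have hfree' := hΓ.mono fun _ => hred.free
    simp only [rename_rename] at hred htype hfree'
    cases htype with | em hl hr =>
    obtain ⟨t, ht, ht'⟩ := ihv (isSimple_rename.2 hs) _ hl (hfree'.em_left (hB.properIn hS))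
    obtain ⟨t₁, ht₁, ht₁'⟩ := ihw (isSimple_rename.2 hs) _ hr (hfree'.em_right (hB.properIn hS))
    exact ⟨_, .trans hred.reduces (ht.em ht₁), .em hB ht' ht₁'⟩
  | @par v w hv hw ihv ihw =>
    by_cases hfree : s.Free 0 ∧ ((par v w).rename ρ).Free 0
    swap
    · exact exists_parallelFormIn_of_not_free (.simple hs)
        (parallelFormIn_rename.2 (.par hv hw)) hfree
    have hred := Redex.em_par_right A _ _ _
      (active_of_not_factorsIn h hT hΓ hA' hfree.1 hfree.2)
    have htype := hred.hasType h
    have hfree' := hΓ.mono fun _ => hred.free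
    cases htype with | par hl hr =>
    obtain ⟨t, ht, ht'⟩ := ihv hs _ hl (hfree'.mono fun _ => .inl)
    obtain ⟨t₁, ht₁, ht₁'⟩ := ihw hs _ hr (hfree'.mono fun _ => .inr)
    exact ⟨_, .trans hred.reduces (ht.par ht₁), .par ht' ht₁'⟩

/-- A channel whose complexity relative to `S` is positive is removed from above parallel forms
whose own kinds have their prime factors in `S`. The renaming makes the induction hypothesis
applicable after a permutation. -/
theorem exists_parallelFormIn_em {S : Set Formula} (hS : SubClosed S) {A T : Formula}
    (hT : ∀ Q, ProperSubformula Q T → Q ∈ S) (hA : ProperIn S A) (hA' : ¬ FactorsIn S A)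
    {Γ : List Formula} {u v : Term} (hu : ParallelFormIn S u) (hv : ParallelFormIn S v)
    (ρ : ℕ → ℕ) (h : HasType Γ (em A (u.rename ρ) v) T)
    (hΓ : FreeStrongIn S Γ (em A (u.rename ρ) v)) :
    ∃ t, Reduces Γ (em A (u.rename ρ) v) t ∧ ParallelFormIn S t := by
  induction hu generalizing Γ v ρ with
  | @simple u hu =>
    have := exists_parallelFormIn_em_of_isSimple (Γ := Γ) hS hT hA hA'
      (isSimple_rename (ρ := ρ) |>.2 hu) hv fun n => n
    rw [rename_id] at this
    exact this h hΓ
  | @em B u w hB hu hw ihu ihw =>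
    by_cases hfree : ((em B u w).rename ρ).Free 0 ∧ v.Free 0
    swap
    · exact exists_parallelFormIn_of_not_free (parallelFormIn_rename.2 (.em hB hu hw)) hv hfree
    have hred := Redex.em_em_left B A _ _ _
      (active_of_not_factorsIn h hT hΓ hA' hfree.1 hfree.2)
    have htype := hred.hasType h
    have hfree' := hΓ.mono fun _ => hred.free
    simp only [rename_rename] at hred htype hfree'
    cases htype with | em hl hr =>
    obtain ⟨t, ht, ht'⟩ := ihu (parallelFormIn_rename.2 hv) _ hl
      (hfree'.em_left (hB.properIn hS))
    obtain ⟨t₁, ht₁, ht₁'⟩ := ihw (parallelFormIn_rename.2 hv) _ hr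
      (hfree'.em_right (hB.properIn hS))
    exact ⟨_, .trans hred.reduces (ht.em ht₁), .em hB ht' ht₁'⟩
  | @par u w hu hw ihu ihw =>
    by_cases hfree : ((par u w).rename ρ).Free 0 ∧ v.Free 0
    swap
    · exact exists_parallelFormIn_of_not_free (parallelFormIn_rename.2 (.par hu hw)) hv hfree
    have hred := Redex.em_par_left A _ _ _
      (active_of_not_factorsIn h hT hΓ hA' hfree.1 hfree.2)
    have htype := hred.hasType h
    have hfree' := hΓ.mono fun _ => hred.free
    cases htype with | par hl hr =>
    obtain ⟨t, ht, ht'⟩ := ihu hv _ hl (hfree'.mono fun _ => .inl)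
    obtain ⟨t₁, ht₁, ht₁'⟩ := ihw hv _ hr (hfree'.mono fun _ => .inr)
    exact ⟨_, .trans hred.reduces (ht.par ht₁), .par ht' ht₁'⟩

/-- One round of lowering: if the proper subformulas of the formulas in `S'` are in `S`, then the
prime factors of all kinds are brought from `S'` into `S`. -/
theorem ParallelFormIn.lower {S S' : Set Formula} (hS : SubClosed S)
    (hSS' : ∀ P ∈ S', ∀ Q, ProperSubformula Q P → Q ∈ S) {T : Formula}
    (hT : ∀ Q, ProperSubformula Q T → Q ∈ S) {Γ : List Formula} {t : Term}
    (ht : ParallelFormIn S' t) (h : HasType Γ t T) (hΓ : FreeStrongIn S Γ t) :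
    ∃ t', Reduces Γ t t' ∧ ParallelFormIn S t' := by
  induction ht generalizing Γ with
  | simple ht => exact ⟨_, .refl, .simple ht⟩
  | @em A u v hA _ _ ihu ihv =>
    have hA : ProperIn S A := fun P hP => hSS' P (hA P hP)
    obtain ⟨u', hu, hu'⟩ : ∃ u', Reduces (neg A :: Γ) u u' ∧ ParallelFormIn S u' := by
      cases h with | em h _ => exact ihu h (hΓ.em_left hA)
    obtain ⟨v', hv, hv'⟩ : ∃ v', Reduces (A :: Γ) v v' ∧ ParallelFormIn S v' := by
      cases h with | em _ h => exact ihv h (hΓ.em_right hA)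
    have hr := hu.em hv
    by_cases hA' : FactorsIn S A
    · exact ⟨_, hr, .em hA' hu' hv'⟩
    · have := exists_parallelFormIn_em (Γ := Γ) hS hT hA hA' hu' hv' fun n => n
      rw [rename_id] at this
      obtain ⟨t, ht, ht'⟩ := this (hr.hasType h) (hr.freeStrongIn hΓ)
      exact ⟨t, .trans hr ht, ht'⟩
  | par _ _ ihu ihv =>
    cases h with | par hu hv =>
    obtain ⟨u', hu, hu'⟩ := ihu hu (hΓ.mono fun _ => .inl)
    obtain ⟨v', hv, hv'⟩ := ihv hv (hΓ.mono fun _ => .inr)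
    exact ⟨_, hu.par hv, .par hu' hv'⟩

theorem ParallelFormIn.mono {S S' : Set Formula} (h : S ⊆ S') {t : Term}
    (ht : ParallelFormIn S t) : ParallelFormIn S' t := by
  induction ht with
  | simple h => exact .simple h
  | em hA _ _ ihu ihv => exact .em (fun P hP => h (hA P hP)) ihu ihv
  | par _ _ ihu ihv => exact .par ihu ihv

theorem exists_parallelFormIn_size_lt {t : Term} (h : t.ParallelForm) :
    ∃ c : ℕ, ParallelFormIn {P | P.size < c} t := by
  have mono : ∀ {c d : ℕ} {t : Term}, c ≤ d → ParallelFormIn {P | P.size < c} t →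
      ParallelFormIn {P | P.size < d} t := fun hcd h =>
    h.mono fun _ hP => lt_of_lt_of_le hP hcd
  induction h with
  | simple h => exact ⟨0, .simple h⟩
  | em A _ _ ihu ihv =>
    obtain ⟨c, hu⟩ := ihu
    obtain ⟨d, hv⟩ := ihv
    refine ⟨max (A.size + 1) (max c d), .em (fun P hP => ?_) (mono (by omega) hu)
      (mono (by omega) hv)⟩
    exact (Nat.lt_succ_of_le (subformula_of_mem_primeFactors hP).size_le).trans_le
      (le_max_left _ _)
  | par _ _ ihu ihv =>
    obtain ⟨c, hu⟩ := ihu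
    obtain ⟨d, hv⟩ := ihv
    exact ⟨max c d, .par (mono (le_max_left _ _) hu) (mono (le_max_right _ _) hv)⟩

/-- All kinds can be brought into `S`, by induction on a bound for the sizes of the prime factors
outside `S`. -/
theorem exists_parallelFormIn {S : Set Formula} (hS : SubClosed S) {T : Formula}
    (hT : ∀ Q, ProperSubformula Q T → Q ∈ S) {Γ : List Formula} {t : Term}
    (ht : t.ParallelForm) (h : HasType Γ t T) (hΓ : FreeStrongIn S Γ t) :
    ∃ t', Reduces Γ t t' ∧ ParallelFormIn S t' := by
  obtain ⟨c, hc⟩ := exists_parallelFormIn_size_lt ht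
  replace hc := hc.mono (Set.subset_union_right (s := S))
  clear ht
  induction c generalizing t with
  | zero => exact ⟨t, .refl, hc.mono fun P hP => hP.resolve_right (Nat.not_lt_zero _)⟩
  | succ c ih =>
    have hclosed : SubClosed (S ∪ {P | P.size < c}) := by
      rintro P (hP | hP) Q hQ
      · exact .inl (hS P hP Q hQ)
      · exact .inr ((properSubformula_iff.1 hQ).2.trans hP)
    have hlower : ∀ P ∈ S ∪ {P | P.size < c + 1}, ∀ Q, ProperSubformula Q P →
        Q ∈ S ∪ {P | P.size < c} := by
      rintro P (hP | hP) Q hQ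
      · exact .inl (hS P hP Q hQ)
      · exact .inr ((properSubformula_iff.1 hQ).2.trans_le (Nat.lt_succ_iff.1 hP))
    obtain ⟨t', hr, ht'⟩ := hc.lower hclosed hlower (fun Q hQ => .inl (hT Q hQ)) h
      fun n X hn hX Q hQ => .inl (hΓ n X hn hX Q hQ)
    obtain ⟨t'', hr', ht''⟩ := ih (hr.hasType h) (hr.freeStrongIn hΓ) ht'
    exact ⟨t'', .trans hr hr', ht''⟩

/-! ### Normal parallel forms -/

/-- Parallel forms of type `T` in which every channel occurs on both sides and has complexity `0`,
and in which the simply typed parts are normal. -/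
inductive NormalForm (T : Formula) : List Formula → Term → Prop
  | simple {Γ : List Formula} {t : Term} : t.IsSimple → IsNf t → NormalForm T Γ t
  | em {Γ : List Formula} {A : Formula} {u v : Term} : u.Free 0 → v.Free 0 →
      FactorsIn (allowed Γ T (em A u v)) A → NormalForm T (neg A :: Γ) u →
      NormalForm T (A :: Γ) v → NormalForm T Γ (em A u v)
  | par {Γ : List Formula} {u v : Term} : NormalForm T Γ u → NormalForm T Γ v →
      NormalForm T Γ (par u v)

theorem NormalForm.parallelForm {T : Formula} {Γ : List Formula} {t : Term}
    (h : NormalForm T Γ t) : t.ParallelForm := by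
  induction h with
  | simple h => exact .simple h
  | em _ _ _ _ _ ihu ihv => exact .em _ ihu ihv
  | par _ _ ihu ihv => exact .par ihu ihv

/-- Normal forms are reflected by renamings that keep the types of the free variables; this is
needed when an operator is erased. -/
theorem NormalForm.of_rename {T : Formula} {Γ Γ' : List Formula} {t : Term} {ρ : ℕ → ℕ}
    (h : NormalForm T Γ' (t.rename ρ)) (hρ : ∀ n, t.Free n → Γ'[ρ n]? = Γ[n]?) :
    NormalForm T Γ t := by
  have lift : ∀ {u : Term} {B : Formula} {Γ Γ' : List Formula} {ρ : ℕ → ℕ},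
      (∀ n, u.Free (n + 1) → Γ'[ρ n]? = Γ[n]?) →
      ∀ n, u.Free n → (B :: Γ')[liftRen ρ n]? = (B :: Γ)[n]? := by
    rintro u B Γ Γ' ρ h (_ | n) hn
    · rfl
    · simpa using h n hn
  have free_zero : ∀ {u : Term} {ρ : ℕ → ℕ}, (u.rename (liftRen ρ)).Free 0 → u.Free 0 := by
    intro u ρ h
    obtain ⟨_ | m, hm, e⟩ := free_rename.1 h
    · exact hm
    · simp at e
  induction t generalizing Γ Γ' ρ with
  | em A u v ihu ihv =>
    cases h with
    | simple h => exact h.elim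
    | em hu0 hv0 hA hu hv =>
      refine .em (free_zero hu0) (free_zero hv0) (fun P hP => ?_)
        (ihu hu (lift fun n hn => hρ n (.inl hn))) (ihv hv (lift fun n hn => hρ n (.inr hn)))
      rcases hA P hP with h | ⟨n, C, hn, hC, h⟩
      · exact .inl h
      · obtain ⟨m, hm, rfl⟩ := (free_rename (t := Term.em A u v) (ρ := ρ)).1 hn
        exact .inr ⟨m, C, hm, by rw [← hρ m hm, hC], h⟩
  | par u v ihu ihv =>
    cases h with
    | simple h => exact h.elim
    | par hu hv =>
      exact .par (ihu hu fun n hn => hρ n (.inl hn)) (ihv hv fun n hn => hρ n (.inr hn))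
  | _ =>
    cases h with
    | simple h h' => exact .simple (isSimple_rename.1 h) (isNf_rename.1 h')

theorem NormalForm.normal {T : Formula} {Γ : List Formula} {t : Term} (h : NormalForm T Γ t)
    (ht : HasType Γ t T) : Normal Γ t := by
  induction h with
  | simple hs hn => exact (normal_iff_intNormal _ (IsSimple.isSimpleParallel hs)).2 hn.intNormal
  | @em Γ A u v hu0 hv0 hA hu hv ihu ihv =>
    have hact : ¬ Active Γ A u v := fun h => ((active_iff ht).1 h).2.2 hA
    cases ht with | em htu htv =>
    rintro ⟨t', C, s, s', e, rfl, hs⟩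
    cases C with
    | hole =>
      obtain rfl : Term.em A u v = s := e
      generalize he : Term.em A u v = t at hs
      cases hs with
      | int hs => cases hs <;> cases he
      | em_elim B u' v' ξ => cases ξ <;> cases he
      | par_elim u' v' ξ => cases ξ <;> cases he
      | erase_right => cases he; exact not_free_rename_succ _ hu0
      | erase_left => cases he; exact not_free_rename_succ _ hv0
      | em_em_left _ _ _ _ _ h | em_em_right _ _ _ _ _ h | em_par_left _ _ _ _ h
        | em_par_right _ _ _ _ h | basic_cross _ _ _ _ h => cases he; exact hact h
      | cross _ _ _ _ _ _ _ _ _ _ _ _ _ _ h => cases he; exact hact h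
      | _ => cases he
    | emL B C r =>
      cases e
      refine ihu htu ⟨_, C, s, s', rfl, rfl, ?_⟩
      simpa [Cxt.binders] using hs
    | emR B r C =>
      cases e
      refine ihv htv ⟨_, C, s, s', rfl, rfl, ?_⟩
      simpa [Cxt.binders] using hs
    | _ => cases e
  | @par Γ u v hu hv ihu ihv =>
    cases ht with | par htu htv =>
    rintro ⟨t', C, s, s', e, rfl, hs⟩
    cases C with
    | hole =>
      obtain rfl : Term.par u v = s := e
      generalize he : Term.par u v = t at hs
      cases hs with
      | int hs => cases hs <;> cases he
      | em_elim B u' v' ξ => cases ξ <;> cases he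
      | par_elim u' v' ξ => cases ξ <;> cases he
      | _ => cases he
    | parL C r =>
      cases e
      exact ihu htu ⟨_, C, s, s', rfl, rfl, hs⟩
    | parR r C =>
      cases e
      exact ihv htv ⟨_, C, s, s', rfl, rfl, hs⟩
    | _ => cases e

/-- Normalization of parallel forms, by induction on the finite set `S`. First, the kinds of all
channels are brought into `S`. Then, normalizing from the inside outwards, a channel is met that
is not covered by its own context only if that context disregards fewer formulas than `S`. -/
theorem exists_normalForm {S : Set Formula} (hfin : S.Finite) (hS : SubClosed S) {T : Formula}
    (hT : ∀ Q, ProperSubformula Q T → Q ∈ S) {Γ : List Formula} {t : Term}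
    (ht : t.ParallelForm) (h : HasType Γ t T) (hΓ : FreeStrongIn S Γ t) :
    ∃ t', Reduces Γ t t' ∧ NormalForm T Γ t' := by
  induction hk : S.ncard using Nat.strong_induction_on generalizing S Γ t with
  | _ k ih =>
  obtain ⟨t₁, hr, ht₁⟩ := exists_parallelFormIn hS hT ht h hΓ
  replace h := hr.hasType h
  replace hΓ := hr.freeStrongIn hΓ
  suffices ∃ t', Reduces Γ t₁ t' ∧ NormalForm T Γ t' by
    obtain ⟨t', hr', ht'⟩ := this
    exact ⟨t', .trans hr hr', ht'⟩
  clear hr ht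
  induction ht₁ generalizing Γ with
  | simple hs =>
    obtain ⟨t', hr, hs', hn⟩ := exists_isNf_of_isSimple h hs
    exact ⟨t', hr, .simple hs' hn⟩
  | @em A u v hA _ _ ihu ihv =>
    have hA' := hA.properIn hS
    obtain ⟨u', hu, hu'⟩ : ∃ u', Reduces (neg A :: Γ) u u' ∧ NormalForm T (neg A :: Γ) u' := by
      cases h with | em h _ => exact ihu h (hΓ.em_left hA')
    obtain ⟨v', hv, hv'⟩ : ∃ v', Reduces (A :: Γ) v v' ∧ NormalForm T (A :: Γ) v' := by
      cases h with | em _ h => exact ihv h (hΓ.em_right hA')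
    have hr := hu.em hv
    suffices ∃ t', Reduces Γ (em A u' v') t' ∧ NormalForm T Γ t' by
      obtain ⟨t', hr', ht'⟩ := this
      exact ⟨t', .trans hr hr', ht'⟩
    by_cases hu0 : u'.Free 0
    swap
    · obtain ⟨w, rfl⟩ := exists_rename_succ hu0
      exact ⟨w, (Redex.erase_right A w v').reduces, hu'.of_rename fun n _ => by simp⟩
    by_cases hv0 : v'.Free 0
    swap
    · obtain ⟨w, rfl⟩ := exists_rename_succ hv0
      exact ⟨w, (Redex.erase_left A u' w).reduces, hv'.of_rename fun n _ => by simp⟩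
    by_cases hc : FactorsIn (allowed Γ T (em A u' v')) A
    · exact ⟨_, .refl, .em hu0 hv0 hc hu' hv'⟩
    · have hsub := allowed_subset hT (hr.freeStrongIn hΓ)
      have hss : allowed Γ T (em A u' v') ⊂ S :=
        ⟨hsub, fun hle => hc fun P hP => hle (hA P hP)⟩
      exact ih _ (hk ▸ Set.ncard_lt_ncard hss hfin) (finite_allowed _ _ _)
        (subClosed_allowed _ _ _) (fun Q hQ => .inl hQ)
        (.em A hu'.parallelForm hv'.parallelForm) (hr.hasType h)
        (fun n X hn hX Q hQ => .inr ⟨n, X, hn, hX, hQ⟩) rfl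
  | par _ _ ihu ihv =>
    cases h with | par hu hv =>
    obtain ⟨u', hu, hu'⟩ := ihu hu (hΓ.mono fun _ => .inl)
    obtain ⟨v', hv, hv'⟩ := ihv hv (hΓ.mono fun _ => .inr)
    exact ⟨_, hu.par hv, .par hu' hv'⟩

theorem exists_normal {Γ : List Formula} {t : Term} {A : Formula} (h : HasType Γ t A) :
    ∃ t', Reduces Γ t t' ∧ HasType Γ t' A ∧ Normal Γ t' ∧ t'.ParallelForm := by
  obtain ⟨t₁, hr, ht₁⟩ := exists_parallelForm t Γ
  have h₁ := hr.hasType h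
  obtain ⟨t₂, hr', ht₂⟩ := exists_normalForm (finite_allowed Γ A t₁) (subClosed_allowed Γ A t₁)
    (fun Q hQ => .inl hQ) ht₁ h₁ fun n X hn hX Q hQ => .inr ⟨n, X, hn, hX, hQ⟩
  have h₂ := hr'.hasType h₁
  exact ⟨t₂, .trans hr hr', h₂, ht₂.normal h₂, ht₂.parallelForm⟩

/-! ### Natural deduction proofs -/

theorem Deriv.hasType_toTerm {Γ : List Formula} {A : Formula} (d : Deriv Γ A) :
    HasType Γ d.toTerm A := by
  induction d with
  | hyp n h => exact .var h
  | topI => exact .tt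
  | impI _ ih => exact .lam ih
  | impE _ _ ih ih' => exact .app ih ih'
  | andI _ _ ih ih' => exact .pair ih ih'
  | andE₀ _ ih => exact .proj_zero ih
  | andE₁ _ ih => exact .proj_one ih
  | efq P hP hP' _ ih => exact .efq hP hP' ih
  | contr _ _ ih ih' => exact .par ih ih'
  | em A _ _ ih ih' => exact .em ih ih'

theorem HasType.exists_deriv {Γ : List Formula} {t : Term} {A : Formula} (h : HasType Γ t A) :
    ∃ d : Deriv Γ A, d.toTerm = t := by
  induction h with
  | var e => exact ⟨.hyp _ e, rfl⟩
  | tt => exact ⟨.topI, rfl⟩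
  | lam _ ih => obtain ⟨d, rfl⟩ := ih; exact ⟨.impI d, rfl⟩
  | app _ _ ih ih' => obtain ⟨d, rfl⟩ := ih; obtain ⟨e, rfl⟩ := ih'; exact ⟨.impE d e, rfl⟩
  | pair _ _ ih ih' => obtain ⟨d, rfl⟩ := ih; obtain ⟨e, rfl⟩ := ih'; exact ⟨.andI d e, rfl⟩
  | proj_zero _ ih => obtain ⟨d, rfl⟩ := ih; exact ⟨.andE₀ d, rfl⟩
  | proj_one _ ih => obtain ⟨d, rfl⟩ := ih; exact ⟨.andE₁ d, rfl⟩
  | efq hP hP' _ ih => obtain ⟨d, rfl⟩ := ih; exact ⟨.efq _ hP hP' d, rfl⟩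
  | par _ _ ih ih' => obtain ⟨d, rfl⟩ := ih; obtain ⟨e, rfl⟩ := ih'; exact ⟨.contr d e, rfl⟩
  | em _ _ ih ih' => obtain ⟨d, rfl⟩ := ih; obtain ⟨e, rfl⟩ := ih'; exact ⟨.em _ d e, rfl⟩

theorem Reduces.exists_deriv {Γ : List Formula} {A : Formula} {d : Deriv Γ A} {t : Term}
    (h : Reduces Γ d.toTerm t) :
    ∃ d' : Deriv Γ A, d'.toTerm = t ∧ Relation.ReflTransGen Deriv.Step d d' := by
  induction h with
  | refl => exact ⟨d, rfl, .refl⟩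
  | tail _ h ih =>
    obtain ⟨d₁, rfl, hd₁⟩ := ih
    obtain ⟨d₂, rfl⟩ := (h.hasType d₁.hasType_toTerm).exists_deriv
    exact ⟨d₂, rfl, hd₁.tail h⟩

end LambdaCL

theorem mainTheorem1 (Γ : List LambdaCL.Formula) (A : LambdaCL.Formula) :
    (∀ t : LambdaCL.Term, LambdaCL.HasType Γ t A →
      ∃ t' : LambdaCL.Term, LambdaCL.Reduces Γ t t' ∧ LambdaCL.HasType Γ t' A ∧
        LambdaCL.Normal Γ t' ∧ t'.ParallelForm) ∧
    (∀ d : LambdaCL.Deriv Γ A,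
      ∃ d' : LambdaCL.Deriv Γ A, Relation.ReflTransGen LambdaCL.Deriv.Step d d' ∧ d'.Normal) := by
  refine ⟨fun t h => LambdaCL.exists_normal h, fun d => ?_⟩
  obtain ⟨t', hr, -, hn, -⟩ := LambdaCL.exists_normal d.hasType_toTerm
  obtain ⟨d', rfl, hd'⟩ := hr.exists_deriv
  exact ⟨d', hd', hn⟩
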